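/- **Setting.** A sender (Alice) is connected to two receivers Bob-1, Bob-2 by two independent binary erasure channels BEC$(p_1)$, BEC$(p_2)$ with a common input. Let $i\in\{1,2\}$ and $\overline i=3-i$. Fix $\lambda\in(0,1)$, real $r_i<\min\{p_i,1-p_i\}-\lambda$, and a real number $\lambda'$ with $0<\lambda'<\min\{r_1,r_2\}$. For each blocklength $n$ put $\ell_i=\lfloor r_in\rfloor$ and $k_i=\lfloor (r_i-\lambda')n\rfloor$ (so $\ell_i=r_in$, $k_i=(r_i-\lambda')n$ whenever these are integers), and fix arbitrary two-universal families $\mathcal K_{ij}$, $j\in\{0,1\}$, of functions $\{0,1\}^{\ell_i}\to\{0,1\}^{k_i}$ (distinct inputs collide with probability at most $2^{-k_i}$). The strings $M_{i0},M_{i1}\in\{0,1\}^{k_i}$ and the choice bits $Z_i\in\{0,1\}$ are independent and uniform. **The pairwise protocol, without additional privacy amplification.** Alice sends a uniform $X^n\in\{0,1\}^n$; Bob-$i$ receives $Y_i^n$, with set of erased positions $E_i$ and set of unerased positions $\overline E_i$. If $|E_i|<\ell_i$ or $|\overline E_i|<\ell_i$, Bob-$i$ aborts. Otherwise Bob-$i$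 draws a uniform $\ell_i$-subset $S_{iZ_i}$ of $\overline E_i$ and a uniform $\ell_i$-subset $S_{i\overline Z_i}$ of $E_i$, and publicly reveals $S_{i0},S_{i1}$. Alice draws $\kappa_{ij}$ uniformly from $\mathcal K_{ij}$ and publicly sends $\kappa_{ij}$ and $M_{ij}\oplus\kappa_{ij}(X|_{S_{ij}})$ for $j=0,1$. Bob-$i$ removes the mask $\kappa_{iZ_i}(X|_{S_{iZ_i}})$, which it can compute from $Y_i^n$, and outputs the result as $\hat M_{iZ_i}$; an aborted run has no output. Let $\mathbf C_i$ be the public transcript between Alice and Bob-$i$ and $\mathbf C=(\mathbf C_1,\mathbf C_2)$. The final views are $V_i=(Z_i,R_{B_i},Y_i^n,\mathbf C_i)$ for Bob-$i$ and $U=(M_{10},M_{11},M_{20},M_{21},R_A,X^n,\mathbf C)$ for Alice, where $R_{B_i}$ and $R_A$ are the local random choices. Mutual information is in bits. **Claim.** 1. The protocol is correct and secure against non-colluding honest-but-curious players: for $i=1,2$, as $n\to\infty$, $$\Pr[\hat M_{iZ_i}\ne M_{iZ_i}]\to0,\qquad I(M_{i\overline Z_i};V_i)\to0,\qquad I(Z_1,Z_2;U)\to0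 .$$ 2. If Bob-$i$ colludes by disclosing its set $E_i$ of erased positions to Alice and Bob-$\overline i$, then, together with the revealed index sets $S_{i0},S_{i1}$, this leaks its whole choice bit: $I(Z_i;U,V_{\overline i},E_i)\to1$ for $i=1,2$. 3. If $\lambda'<r_i(1-p_{\overline i})$ for some $i\in\{1,2\}$, then colluding receivers learn about the strings that they have not chosen: $I(M_{1\overline Z_1},M_{2\overline Z_2};V_1,V_2)\to\infty$. Hence the protocol is not secure against colluding players, i.e. the following criteria do not all hold: $\Pr[\hat M_{iZ_i}\neq M_{iZ_i}]\to0$, $I(M_{1\overline Z_1},M_{2\overline Z_2};V_1,V_2)\to0$, $I(Z_i;U,V_{\overline i})\to0$, $I(Z_1,Z_2;U)\to0$, and $I(M_{i0},M_{i1},M_{\overline i\,\overline Z_{\overline i}},Z_i;V_{\overline i})\to0$ (for $i=1,2$). -/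

import Mathlib

noncomputable section

namespace BroadcastOT

/-! ### Finite probability and information (in bits) -/

/-- Probability of the event `A` under the probability weights `w` on a finite sample space. -/
def pr {Ω : Type*} [Fintype Ω] (w : Ω → ℝ) (A : Set Ω) : ℝ :=
  ∑ ω, A.indicator w ω

open Classical in
/-- Shannon entropy, in bits, of the random variable `f`. -/
def entropy {Ω α : Type*} [Fintype Ω] (w : Ω → ℝ) (f : Ω → α) : ℝ :=
  (∑ a ∈ Finset.univ.image f, Real.negMulLog (pr w {ω | f ω = a})) / Real.log 2

/-- Mutual information `I(f ; g) = H(f) + H(g) - H(f, g)`, in bits. -/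
def mutualInfo {Ω α β : Type*} [Fintype Ω] (w : Ω → ℝ) (f : Ω → α) (g : Ω → β) : ℝ :=
  entropy w f + entropy w g - entropy w (fun ω => (f ω, g ω))

/-! ### Two-universal hashing -/

/-- Bit strings of length `a`. -/
abbrev Bits (a : ℕ) : Type := Fin a → Bool

/-- Bitwise exclusive or. -/
def bxor {a : ℕ} (u v : Bits a) : Bits a := fun t => xor (u t) (v t)

/-- A two-universal family of hash functions `{0,1}^a → {0,1}^b`, indexed by a finite seed set:
for a uniform seed, distinct inputs collide with probability at most `2^(-b)`. -/
structure TwoUniversalFamily (a b : ℕ) where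
  Seed : Type
  [fintypeSeed : Fintype Seed]
  [nonemptySeed : Nonempty Seed]
  hash : Seed → Bits a → Bits b
  two_universal : ∀ x y : Bits a, x ≠ y →
    (Nat.card {s : Seed // hash s x = hash s y} : ℝ) / (Nat.card Seed : ℝ) ≤ ((2 : ℝ) ^ b)⁻¹

attribute [instance] TwoUniversalFamily.fintypeSeed TwoUniversalFamily.nonemptySeed

/-! ### The protocol at a fixed blocklength

The two receivers are indexed by `Fin 2`; a choice bit, and the index of a string, is a `Bool`. -/

/-- The data of one run: blocklength `n`, erasure probabilities `p i`, size `l i` of the index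
sets, string length `k i`, and the hash families from which the keys are drawn. -/
structure Session where
  n : ℕ
  p : Fin 2 → ℝ
  l : Fin 2 → ℕ
  k : Fin 2 → ℕ
  K : (i : Fin 2) → Bool → TwoUniversalFamily (l i) (k i)

/-- The index of the other receiver. -/
def other (i : Fin 2) : Fin 2 := 1 - i

/-- Local randomness for drawing a subset of prescribed size `a`: for every ground set `E` with at
least `a` elements it holds an `a`-element subset of `E`. Under the uniform distribution on samplers
the value at each `E` is uniform among the `a`-element subsets of `E`. -/
abbrev Sampler (n a : ℕ) : Type :=
  (E : {E : Finset (Fin n) // a ≤ E.card}) → {A : Finset (Fin n) // A ⊆ E.1 ∧ A.card = a}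

/-- An elementary outcome: everything that is drawn at random in one run. -/
@[ext]
structure Outcome (c : Session) where
  /-- choice bits `Z i` -/
  z : Fin 2 → Bool
  /-- the strings `M i j` -/
  m : (i : Fin 2) → Bool → Bits (c.k i)
  /-- the channel input `X` -/
  x : Bits c.n
  /-- erasure indicators: `e i t` says that receiver `i` sees an erasure at time `t` -/
  e : Fin 2 → Fin c.n → Bool
  /-- randomness of receiver `i` for drawing from the unerased positions -/
  drawKnown : (i : Fin 2) → Sampler c.n (c.l i)
  /-- randomness of receiver `i` for drawing from the erased positions -/
  drawErased : (i : Fin 2) → Sampler c.n (c.l i)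
  /-- the sender's hash seeds -/
  seed : (i : Fin 2) → (j : Bool) → (c.K i j).Seed

/-- The components of an outcome as a tuple. -/
def Outcome.equivProd (c : Session) : Outcome c ≃
    (Fin 2 → Bool) × ((i : Fin 2) → Bool → Bits (c.k i)) × Bits c.n × (Fin 2 → Fin c.n → Bool) ×
      ((i : Fin 2) → Sampler c.n (c.l i)) × ((i : Fin 2) → Sampler c.n (c.l i)) ×
      ((i : Fin 2) → (j : Bool) → (c.K i j).Seed) where
  toFun ω := (ω.z, ω.m, ω.x, ω.e, ω.drawKnown, ω.drawErased, ω.seed)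
  invFun q := ⟨q.1, q.2.1, q.2.2.1, q.2.2.2.1, q.2.2.2.2.1, q.2.2.2.2.2.1, q.2.2.2.2.2.2⟩
  left_inv _ := rfl
  right_inv _ := rfl

instance (c : Session) : Fintype (Outcome c) := Fintype.ofEquiv _ (Outcome.equivProd c).symm

/-- The weight of a single element under the uniform distribution. -/
def unif (α : Type*) [Fintype α] : ℝ := (Fintype.card α : ℝ)⁻¹

/-- The probability of an erasure pattern: the erasure indicators of receiver `i` are i.i.d.
Bernoulli(`p i`), independently for the two receivers. -/
def erasureProb (c : Session) (e : Fin 2 → Fin c.n → Bool) : ℝ :=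
  ∏ i, ∏ t, if e i t then c.p i else 1 - c.p i

/-- The joint law: all components are independent, the erasure pattern follows `erasureProb`, and
every other component is uniform. -/
def law (c : Session) (ω : Outcome c) : ℝ :=
  unif (Fin 2 → Bool) * (unif ((i : Fin 2) → Bool → Bits (c.k i)) * (unif (Bits c.n) *
    (erasureProb c ω.e *
      (unif ((i : Fin 2) → Sampler c.n (c.l i)) * (unif ((i : Fin 2) → Sampler c.n (c.l i)) *
        unif ((i : Fin 2) → (j : Bool) → (c.K i j).Seed))))))

theorem sum_unif (α : Type*) [Fintype α] [Nonempty α] : ∑ _a : α, unif α = 1 := by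
  simp [unif]

theorem sum_weight_mul {α β : Type*} [Fintype α] [Fintype β] {f : α → ℝ} {g : β → ℝ}
    (hf : ∑ a, f a = 1) (hg : ∑ b, g b = 1) : ∑ q : α × β, f q.1 * g q.2 = 1 := by
  rw [Fintype.sum_prod_type, ← Finset.sum_mul_sum, hf, hg, one_mul]

instance (n a : ℕ) : Nonempty (Sampler n a) :=
  ⟨fun E => ⟨(Finset.exists_subset_card_eq E.2).choose,
    (Finset.exists_subset_card_eq E.2).choose_spec⟩⟩

theorem sum_erasureProb (c : Session) : ∑ e, erasureProb c e = 1 := by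
  unfold erasureProb
  rw [← Fintype.prod_sum (f := fun i (u : Fin c.n → Bool) =>
    ∏ t, if u t then c.p i else 1 - c.p i)]
  refine Finset.prod_eq_one fun i _ => ?_
  rw [← Fintype.prod_sum (f := fun (_ : Fin c.n) (b : Bool) => if b then c.p i else 1 - c.p i)]
  simp

/-- The weights of the joint law add up to one. -/
theorem sum_law (c : Session) : ∑ ω, law c ω = 1 := by
  have h := sum_weight_mul (sum_unif (Fin 2 → Bool)) <|
    sum_weight_mul (sum_unif ((i : Fin 2) → Bool → Bits (c.k i))) <|
    sum_weight_mul (sum_unif (Bits c.n)) <|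
    sum_weight_mul (sum_erasureProb c) <|
    sum_weight_mul (sum_unif ((i : Fin 2) → Sampler c.n (c.l i))) <|
    sum_weight_mul (sum_unif ((i : Fin 2) → Sampler c.n (c.l i)))
      (sum_unif ((i : Fin 2) → (j : Bool) → (c.K i j).Seed))
  exact (Fintype.sum_equiv (Outcome.equivProd c) _ _ fun _ => rfl).trans h

variable {c : Session}

namespace Outcome

/-- Output of the erasure channel to receiver `i`; `none` is the erasure symbol. -/
def y (ω : Outcome c) (i : Fin 2) : Fin c.n → Option Bool :=
  fun t => if ω.e i t then none else some (ω.x t)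

/-- Positions that receiver `i` sees erased. -/
def erased (ω : Outcome c) (i : Fin 2) : Finset (Fin c.n) :=
  Finset.univ.filter fun t => ω.y i t = none

/-- Positions that receiver `i` sees unerased. -/
def unerased (ω : Outcome c) (i : Fin 2) : Finset (Fin c.n) :=
  Finset.univ.filter fun t => ω.y i t ≠ none

end Outcome

/-- The revealed index sets. -/
abbrev IndexSet (n a : ℕ) : Type := {A : Finset (Fin n) // A.card = a}

/-- The substring of `x` on the positions in `S`, taken in increasing order. -/
def restrict {n a : ℕ} {β : Type} (x : Fin n → β) (S : IndexSet n a) : Fin a → β :=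
  fun t => x (S.1.orderEmbOfFin S.2 t)

/-- Public messages between the sender and receiver `i` in a run that is not aborted: the sets
`S i 0`, `S i 1`, the hash functions, and the two masked strings. -/
structure Messages (c : Session) (i : Fin 2) where
  sets : Bool → IndexSet c.n (c.l i)
  seed : (j : Bool) → (c.K i j).Seed
  masked : Bool → Bits (c.k i)

namespace Outcome

open Classical in
/-- The index sets announced by receiver `i`: the set with the label `Z i` is drawn from the
unerased positions, the one with the other label from the erased positions. The receiver aborts
(`none`) if it sees too few erased or too few unerased positions. -/
def sets (ω : Outcome c) (i : Fin 2) : Option (Bool → IndexSet c.n (c.l i)) :=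
  if h : c.l i ≤ (ω.unerased i).card ∧ c.l i ≤ (ω.erased i).card then
    some fun j =>
      if j = ω.z i then
        ⟨(ω.drawKnown i ⟨ω.unerased i, h.1⟩).1, (ω.drawKnown i ⟨ω.unerased i, h.1⟩).2.2⟩
      else
        ⟨(ω.drawErased i ⟨ω.erased i, h.2⟩).1, (ω.drawErased i ⟨ω.erased i, h.2⟩).2.2⟩
  else none

/-- The public transcript `C i` between the sender and receiver `i`; `none` if aborted. -/
def transcript (ω : Outcome c) (i : Fin 2) : Option (Messages c i) :=
  (ω.sets i).map fun S =>
    { sets := S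
      seed := ω.seed i
      masked := fun j => bxor (ω.m i j) ((c.K i j).hash (ω.seed i j) (restrict ω.x (S j))) }

end Outcome

/-- The final view `V i = (Z i, R_B i, Y i, C i)` of receiver `i`. -/
structure ReceiverView (c : Session) (i : Fin 2) where
  z : Bool
  drawKnown : Sampler c.n (c.l i)
  drawErased : Sampler c.n (c.l i)
  y : Fin c.n → Option Bool
  transcript : Option (Messages c i)

/-- The final view `U = (M, R_A, X, C)` of the sender. -/
structure SenderView (c : Session) where
  m : (i : Fin 2) → Bool → Bits (c.k i)
  seed : (i : Fin 2) → (j : Bool) → (c.K i j).Seed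
  x : Bits c.n
  transcript : (i : Fin 2) → Option (Messages c i)

/-- The output of receiver `i` as a function of its view: it removes the mask of the string it has
chosen, computing the key from its own channel output; `none` if the run was aborted. -/
def ReceiverView.decode {i : Fin 2} (v : ReceiverView c i) : Option (Bits (c.k i)) :=
  v.transcript.map fun C =>
    bxor (C.masked v.z) ((c.K i v.z).hash (C.seed v.z)
      (restrict (fun t => (v.y t).getD false) (C.sets v.z)))

namespace Outcome

def V (ω : Outcome c) (i : Fin 2) : ReceiverView c i :=
  ⟨ω.z i, ω.drawKnown i, ω.drawErased i, ω.y i, ω.transcript i⟩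

def U (ω : Outcome c) : SenderView c :=
  ⟨ω.m, ω.seed, ω.x, ω.transcript⟩

/-- The string that receiver `i` has chosen. -/
def chosen (ω : Outcome c) (i : Fin 2) : Bits (c.k i) := ω.m i (ω.z i)

/-- The string that receiver `i` has not chosen. -/
def unchosen (ω : Outcome c) (i : Fin 2) : Bits (c.k i) := ω.m i (!ω.z i)

end Outcome

/-! ### Security criteria for a sequence of runs -/

open Filter Topology

/-- Each receiver fails to output its chosen string (in particular, aborts) with vanishing
probability. -/
def Correct (c : ℕ → Session) : Prop :=
  ∀ i : Fin 2, Tendsto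
    (fun n => pr (law (c n)) {ω | (ω.V i).decode ≠ some (ω.chosen i)}) atTop (𝓝 0)

/-- Correctness and security against non-colluding honest-but-curious players. -/
structure NonColludingSecure (c : ℕ → Session) : Prop where
  correct : Correct c
  sender : ∀ i : Fin 2, Tendsto
    (fun n => mutualInfo (law (c n)) (fun ω => ω.unchosen i) (fun ω => ω.V i)) atTop (𝓝 0)
  receivers : Tendsto
    (fun n => mutualInfo (law (c n)) (fun ω => (ω.z 0, ω.z 1)) (fun ω => ω.U)) atTop (𝓝 0)

/-- `I(M_{1, not Z_1}, M_{2, not Z_2} ; V_1, V_2)`: what the two receivers learn jointly about the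
strings they have not chosen. -/
def jointLeakage (c : Session) : ℝ :=
  mutualInfo (law c) (fun ω => (ω.unchosen 0, ω.unchosen 1)) (fun ω => (ω.V 0, ω.V 1))

/-- Correctness and security against colluding honest-but-curious players. -/
structure ColludingSecure (c : ℕ → Session) : Prop where
  correct : Correct c
  sender : Tendsto (fun n => jointLeakage (c n)) atTop (𝓝 0)
  receiver_vs_coalition : ∀ i : Fin 2, Tendsto
    (fun n => mutualInfo (law (c n)) (fun ω => ω.z i) (fun ω => (ω.U, ω.V (other i))))
    atTop (𝓝 0)
  receivers : Tendsto
    (fun n => mutualInfo (law (c n)) (fun ω => (ω.z 0, ω.z 1)) (fun ω => ω.U)) atTop (𝓝 0)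
  session_vs_other : ∀ i : Fin 2, Tendsto
    (fun n => mutualInfo (law (c n))
      (fun ω => (ω.m i false, ω.m i true, ω.unchosen (other i), ω.z i))
      (fun ω => ω.V (other i))) atTop (𝓝 0)

/-- The information about `Z_i` available to the sender and the other receiver once receiver `i`
has disclosed which positions were erased for it. -/
def choiceLeakage (c : Session) (i : Fin 2) : ℝ :=
  mutualInfo (law c) (fun ω => ω.z i) (fun ω => (ω.U, ω.V (other i), ω.erased i))

/-- Size `r n` of the index sets, rounded down to an integer. -/
def setSize (r : ℝ) (n : ℕ) : ℕ := ⌊r * n⌋₊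

/-- String length `(r - s) n`, rounded down to an integer. -/
def stringLength (r s : ℝ) (n : ℕ) : ℕ := ⌊(r - s) * n⌋₊

/-- The pairwise protocol of blocklength `n` over two independent erasure channels, with set sizes
`r i * n` and string lengths `(r i - s) * n`, without the additional privacy amplification. -/
def pairwiseProtocol (p r : Fin 2 → ℝ) (s : ℝ)
    (K : (n : ℕ) → (i : Fin 2) → Bool →
      TwoUniversalFamily (setSize (r i) n) (stringLength (r i) s n)) (n : ℕ) : Session where
  n := n
  p := p
  l := fun i => setSize (r i) n
  k := fun i => stringLength (r i) s n
  K := K n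

end BroadcastOT

end

/-! Outside aborted runs the protocol can be analysed exactly, by symmetry and counting; an abort
has exponentially small probability because `r i` lies strictly below both `p i` and `1 - p i` (a
Chernoff bound, `exists_tail_bound`).

Non-colluding security. A run that is not aborted decodes correctly, since the chosen set is
unerased. Given the view of receiver `i`, the input on the unchosen set is still uniform, so the
likelihood ratio of the unchosen string and the view is `2 ^ (k - l)` times the number of inputs
having the same hash value (`pr_unchosen_V_of_some`). Averaging over the seeds and using
two-universality bounds its mean by `1 + 2 ^ (k - l)`, and mutual information is at most the
χ²-divergence, which decays exponentially in `n`. Against the sender, a permutation exchanging the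
two revealed sets, applied to the erasures and samplers while the choice bit is flipped, preserves
the law and the sender's view. Hence the choice bits are uniform given that view, and the leakage is
exactly zero at every blocklength.

Leakage. The chosen set avoids the erased positions and the unchosen set lies inside them, so the
disclosed erased set together with the nonempty revealed sets determines the choice bit. For
colluding receivers, the other receiver knows the input on its own unerased positions. The unchosen
string of receiver `i` is then determined by the bits on the part of the unchosen set erased for
both. This part has mean size at most `p (other i) * l i`, the two erasure patterns being
independent. Counting compatible values (`entropy_sub_le_mutualInfo`) gives a leakage of at least `k
i * (1 - abortProb c i) - p (other i) * l i` (`le_jointLeakage`), which grows linearly when `lam' <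
r i * (1 - p (other i))`. -/

namespace BroadcastOT

open Filter Topology

/-! ### Entropy and mutual information on a finite probability space -/

section Information

variable {Ω α β : Type*} [Fintype Ω] {w : Ω → ℝ}

theorem pr_nonneg (hw : ∀ ω, 0 ≤ w ω) (A : Set Ω) : 0 ≤ pr w A :=
  Finset.sum_nonneg fun ω _ => Set.indicator_nonneg (fun ω _ => hw ω) ω

theorem pr_mono (hw : ∀ ω, 0 ≤ w ω) {A B : Set Ω} (h : A ⊆ B) : pr w A ≤ pr w B :=
  Finset.sum_le_sum fun ω _ => Set.indicator_le_indicator_of_subset h hw ω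

theorem le_pr (hw : ∀ ω, 0 ≤ w ω) {A : Set Ω} {ω : Ω} (h : ω ∈ A) : w ω ≤ pr w A := by
  have := Finset.single_le_sum (f := A.indicator w)
    (fun ω _ => Set.indicator_nonneg (fun ω _ => hw ω) ω) (Finset.mem_univ ω)
  simpa [h, pr] using this

theorem pr_fiber_pos (hw : ∀ ω, 0 ≤ w ω) (f : Ω → α) {ω : Ω} (h : 0 < w ω) :
    0 < pr w {ω' | f ω' = f ω} :=
  h.trans_le (le_pr hw rfl)

theorem pr_eq_sum_ite (A : Ω → Prop) [DecidablePred A] :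
    pr w {ω | A ω} = ∑ ω, if A ω then w ω else 0 :=
  Finset.sum_congr rfl fun ω _ => by by_cases h : A ω <;> simp [h]

theorem sum_mul_comp [DecidableEq α] (f : Ω → α) (F : α → ℝ) :
    ∑ ω, w ω * F (f ω) = ∑ a ∈ Finset.univ.image f, pr w {ω | f ω = a} * F a := by
  rw [← Finset.sum_fiberwise_of_maps_to (t := Finset.univ.image f) (g := f)
    (fun ω _ => Finset.mem_image_of_mem f (Finset.mem_univ ω))]
  refine Finset.sum_congr rfl fun a _ => ?_
  have hpr : pr w {ω | f ω = a} = ∑ ω with f ω = a, w ω := by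
    simp [pr, Set.indicator_apply, Finset.sum_filter]
  rw [hpr, Finset.sum_mul]
  refine Finset.sum_congr rfl fun ω hω => ?_
  rw [(Finset.mem_filter.1 hω).2]

theorem sum_pr_image [DecidableEq α] (f : Ω → α) :
    ∑ a ∈ Finset.univ.image f, pr w {ω | f ω = a} = ∑ ω, w ω := by
  simpa using (sum_mul_comp (w := w) f fun _ => 1).symm

theorem sum_pr_fiber [Fintype α] (f : Ω → α) : ∑ a, pr w {ω | f ω = a} = ∑ ω, w ω := by
  classical
  simp_rw [pr_eq_sum_ite]
  rw [Finset.sum_comm]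
  simp

theorem sum_pr_fiber_inter [Fintype α] (f : Ω → α) (g : Ω → β) (b : β) :
    ∑ a, pr w {ω | (f ω, g ω) = (a, b)} = pr w {ω | g ω = b} := by
  classical
  simp_rw [pr_eq_sum_ite]
  rw [Finset.sum_comm]
  refine Finset.sum_congr rfl fun ω _ => ?_
  by_cases h : g ω = b <;> simp [h]

/-- Writing entropy as a mean over outcomes lets later inequalities be checked outcome by outcome,
with outcomes of weight zero dropping out before any logarithm of zero matters. -/
theorem entropy_eq (f : Ω → α) :
    entropy w f = -(∑ ω, w ω * Real.log (pr w {ω' | f ω' = f ω})) / Real.log 2 := by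
  classical
  rw [entropy, sum_mul_comp f fun a => Real.log (pr w {ω' | f ω' = a}), ← Finset.sum_neg_distrib]
  congr 1
  refine Finset.sum_congr (by congr) fun a _ => ?_
  rw [Real.negMulLog, neg_mul]

/-- The entropy of a uniformly distributed random variable. -/
theorem entropy_of_uniform (h1 : ∑ ω, w ω = 1) (f : Ω → α) (N : ℝ)
    (hf : ∀ ω, pr w {ω' | f ω' = f ω} = N⁻¹) : entropy w f = Real.log N / Real.log 2 := by
  rw [entropy_eq]
  simp [hf, ← Finset.sum_mul, h1]

theorem mutualInfo_eq (f : Ω → α) (g : Ω → β) :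
    mutualInfo w f g = (∑ ω, w ω * (Real.log (pr w {ω' | (f ω', g ω') = (f ω, g ω)}) -
      Real.log (pr w {ω' | f ω' = f ω}) - Real.log (pr w {ω' | g ω' = g ω}))) / Real.log 2 := by
  rw [mutualInfo, entropy_eq, entropy_eq, entropy_eq]
  simp only [mul_sub, Finset.sum_sub_distrib]
  ring

/-- Mutual information is at most the `χ²`-divergence from independence. -/
theorem mutualInfo_le_of_sum_ratio_le (hw : ∀ ω, 0 ≤ w ω) (h1 : ∑ ω, w ω = 1) (f : Ω → α)
    (g : Ω → β) {C : ℝ}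
    (h : ∑ ω, w ω * (pr w {ω' | (f ω', g ω') = (f ω, g ω)} /
      (pr w {ω' | f ω' = f ω} * pr w {ω' | g ω' = g ω})) ≤ 1 + C) :
    mutualInfo w f g ≤ C / Real.log 2 := by
  rw [mutualInfo_eq]
  refine div_le_div_of_nonneg_right ?_ (Real.log_pos one_lt_two).le
  have key : ∀ ω, w ω * (Real.log (pr w {ω' | (f ω', g ω') = (f ω, g ω)}) -
      Real.log (pr w {ω' | f ω' = f ω}) - Real.log (pr w {ω' | g ω' = g ω})) ≤
      w ω * (pr w {ω' | (f ω', g ω') = (f ω, g ω)} /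
      (pr w {ω' | f ω' = f ω} * pr w {ω' | g ω' = g ω})) - w ω := by
    intro ω
    rcases (hw ω).eq_or_lt with h0 | h0
    · simp [← h0]
    have hf := pr_fiber_pos hw f h0
    have hg := pr_fiber_pos hw g h0
    have hfg := pr_fiber_pos hw (fun ω => (f ω, g ω)) h0
    have := Real.log_le_sub_one_of_pos (div_pos hfg (mul_pos hf hg))
    rw [Real.log_div hfg.ne' (mul_pos hf hg).ne', Real.log_mul hf.ne' hg.ne'] at this
    nlinarith
  have := Finset.sum_le_sum fun ω (_ : ω ∈ Finset.univ) => key ω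
  rw [Finset.sum_sub_distrib, h1] at this
  linarith

/-- Gibbs' inequality: apply `log t ≤ t - 1` to the product of the marginals over the joint
probability. The product measure gives the image of the pair `(f, g)` mass at most one. -/
theorem mutualInfo_nonneg (hw : ∀ ω, 0 ≤ w ω) (h1 : ∑ ω, w ω = 1) (f : Ω → α) (g : Ω → β) :
    0 ≤ mutualInfo w f g := by
  classical
  rw [mutualInfo_eq]
  refine div_nonneg ?_ (Real.log_pos one_lt_two).le
  have key : ∀ ω, w ω - w ω * ((pr w {ω' | f ω' = f ω} * pr w {ω' | g ω' = g ω}) /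
      pr w {ω' | (f ω', g ω') = (f ω, g ω)}) ≤
      w ω * (Real.log (pr w {ω' | (f ω', g ω') = (f ω, g ω)}) -
      Real.log (pr w {ω' | f ω' = f ω}) - Real.log (pr w {ω' | g ω' = g ω})) := by
    intro ω
    rcases (hw ω).eq_or_lt with h0 | h0
    · simp [← h0]
    have hf := pr_fiber_pos hw f h0
    have hg := pr_fiber_pos hw g h0
    have hfg := pr_fiber_pos hw (fun ω => (f ω, g ω)) h0
    have := Real.log_le_sub_one_of_pos (div_pos (mul_pos hf hg) hfg)
    rw [Real.log_div (mul_pos hf hg).ne' hfg.ne', Real.log_mul hf.ne' hg.ne'] at this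
    nlinarith
  have hsum := Finset.sum_le_sum fun ω (_ : ω ∈ Finset.univ) => key ω
  refine le_trans ?_ hsum
  rw [Finset.sum_sub_distrib, h1, sub_nonneg,
    sum_mul_comp (fun ω => (f ω, g ω)) fun q : α × β =>
      (pr w {ω' | f ω' = q.1} * pr w {ω' | g ω' = q.2}) / pr w {ω' | (f ω', g ω') = q}]
  refine (Finset.sum_le_sum (g := fun q : α × β =>
    pr w {ω' | f ω' = q.1} * pr w {ω' | g ω' = q.2}) fun q _ => ?_).trans ?_
  · rcases (pr_nonneg hw {ω' | (f ω', g ω') = q}).eq_or_lt with h0 | h0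
    · rw [← h0, zero_mul]
      exact mul_nonneg (pr_nonneg hw _) (pr_nonneg hw _)
    · rw [mul_div_cancel₀ _ h0.ne']
  calc ∑ q ∈ Finset.univ.image (fun ω => (f ω, g ω)),
        pr w {ω' | f ω' = q.1} * pr w {ω' | g ω' = q.2}
      ≤ ∑ q ∈ Finset.univ.image f ×ˢ Finset.univ.image g,
        pr w {ω' | f ω' = q.1} * pr w {ω' | g ω' = q.2} := by
        refine Finset.sum_le_sum_of_subset_of_nonneg ?_ fun _ _ _ =>
          mul_nonneg (pr_nonneg hw _) (pr_nonneg hw _)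
        intro q hq
        obtain ⟨ω, -, rfl⟩ := Finset.mem_image.1 hq
        simp
    _ = 1 := by
        rw [Finset.sum_product]
        dsimp only
        rw [← Finset.sum_mul_sum, sum_pr_image, sum_pr_image, h1, one_mul]

theorem mutualInfo_le_entropy (hw : ∀ ω, 0 ≤ w ω) (f : Ω → α) (g : Ω → β) :
    mutualInfo w f g ≤ entropy w f := by
  rw [mutualInfo, add_sub_assoc, add_le_iff_nonpos_right, sub_nonpos, entropy_eq, entropy_eq]
  refine div_le_div_of_nonneg_right (neg_le_neg (Finset.sum_le_sum fun ω _ => ?_))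
    (Real.log_pos one_lt_two).le
  rcases (hw ω).eq_or_lt with h0 | h0
  · simp [← h0]
  refine mul_le_mul_of_nonneg_left (Real.log_le_log (pr_fiber_pos hw (fun ω => (f ω, g ω)) h0)
    (pr_mono hw fun ω' h => ?_)) h0.le
  exact (Prod.ext_iff.1 h).2

/-- The conditional entropy of `f` given `g` is at most the mean of the logarithm of the number of
values of `f` that are compatible with the value of `g`. -/
theorem entropy_sub_le_mutualInfo [DecidableEq α] [DecidableEq β] (hw : ∀ ω, 0 ≤ w ω)
    (h1 : ∑ ω, w ω = 1) (f : Ω → α) (g : Ω → β) (B : Ω → ℝ) (hBg : B.FactorsThrough g)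
    (hB : ∀ ω₀, (((Finset.univ.filter fun ω => g ω = g ω₀).image f).card : ℝ) ≤ B ω₀) :
    entropy w f - (∑ ω, w ω * Real.log (B ω)) / Real.log 2 ≤ mutualInfo w f g := by
  obtain ⟨B, rfl⟩ := (Function.factorsThrough_iff B).1 hBg
  simp only [Function.comp_apply] at hB ⊢
  have hB1 : ∀ ω, 0 < B (g ω) := fun ω => by
    refine lt_of_lt_of_le ?_ (hB ω)
    exact_mod_cast Finset.card_pos.2 ⟨f ω, Finset.mem_image_of_mem f (by simp)⟩
  rw [mutualInfo, add_sub_assoc, sub_eq_add_neg, add_le_add_iff_left, entropy_eq, entropy_eq,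
    ← neg_div, ← sub_div]
  refine div_le_div_of_nonneg_right ?_ (Real.log_pos one_lt_two).le
  rw [neg_sub_neg, ← Finset.sum_sub_distrib, neg_le_iff_add_nonneg, ← Finset.sum_add_distrib]
  -- This is `log t ≥ 1 - 1 / t` for `t` the conditional probability of `f` given `g` times `B`,
  -- i.e. a comparison with the conditional weight `1 / B`.
  have key : ∀ ω, w ω - w ω * (pr w {ω' | g ω' = g ω} /
      (pr w {ω' | (f ω', g ω') = (f ω, g ω)} * B (g ω))) ≤
      w ω * Real.log (pr w {ω' | (f ω', g ω') = (f ω, g ω)}) -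
      w ω * Real.log (pr w {ω' | g ω' = g ω}) + w ω * Real.log (B (g ω)) := by
    intro ω
    rcases (hw ω).eq_or_lt with h0 | h0
    · simp [← h0]
    have hg := pr_fiber_pos hw g h0
    have hfg := pr_fiber_pos hw (fun ω => (f ω, g ω)) h0
    have := Real.log_le_sub_one_of_pos (div_pos hg (mul_pos hfg (hB1 ω)))
    rw [Real.log_div hg.ne' (mul_pos hfg (hB1 ω)).ne', Real.log_mul hfg.ne' (hB1 ω).ne'] at this
    nlinarith
  have hsum := Finset.sum_le_sum fun ω (_ : ω ∈ Finset.univ) => key ω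
  refine le_trans ?_ hsum
  rw [Finset.sum_sub_distrib, h1, sub_nonneg,
    sum_mul_comp (fun ω => (f ω, g ω)) fun q : α × β =>
      pr w {ω' | g ω' = q.2} / (pr w {ω' | (f ω', g ω') = q} * B q.2)]
  have hBq : ∀ q ∈ Finset.univ.image (fun ω => (f ω, g ω)), 0 < B q.2 := by
    intro q hq
    obtain ⟨ω, -, rfl⟩ := Finset.mem_image.1 hq
    exact hB1 ω
  refine (Finset.sum_le_sum (g := fun q : α × β => pr w {ω' | g ω' = q.2} / B q.2)
    fun q hq => ?_).trans ?_
  · rcases (pr_nonneg hw {ω' | (f ω', g ω') = q}).eq_or_lt with h0 | h0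
    · rw [← h0, zero_mul]
      exact div_nonneg (pr_nonneg hw _) (hBq q hq).le
    · rw [← mul_div_assoc, mul_div_mul_left _ _ h0.ne']
  calc ∑ q ∈ Finset.univ.image (fun ω => (f ω, g ω)), pr w {ω' | g ω' = q.2} / B q.2
      = ∑ b ∈ Finset.univ.image g, ∑ q ∈ (Finset.univ.image (fun ω => (f ω, g ω))).filter
          (fun q => q.2 = b), pr w {ω' | g ω' = q.2} / B q.2 := by
        refine (Finset.sum_fiberwise_of_maps_to (fun q hq => ?_) _).symm
        obtain ⟨ω, -, rfl⟩ := Finset.mem_image.1 hq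
        simp
    -- Over a fixed value `b` lie at most `B b` pairs, each contributing the probability of `b`
    -- divided by `B b`.
    _ ≤ ∑ b ∈ Finset.univ.image g, pr w {ω' | g ω' = b} := by
        refine Finset.sum_le_sum fun b hb => ?_
        obtain ⟨ω₀, -, rfl⟩ := Finset.mem_image.1 hb
        rw [Finset.sum_congr rfl (g := fun _ => pr w {ω' | g ω' = g ω₀} / B (g ω₀))
          (fun q hq => by rw [(Finset.mem_filter.1 hq).2]), Finset.sum_const, nsmul_eq_mul,
          ← mul_div_assoc, div_le_iff₀ (hB1 ω₀), mul_comm]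
        refine mul_le_mul_of_nonneg_left (le_trans ?_ (hB ω₀)) (pr_nonneg hw _)
        refine Nat.cast_le.2 (Finset.card_le_card_of_injOn Prod.fst ?_ ?_)
        · intro q hq
          obtain ⟨hq, h2⟩ := Finset.mem_filter.1 hq
          obtain ⟨ω, -, rfl⟩ := Finset.mem_image.1 hq
          exact Finset.mem_coe.2 (Finset.mem_image_of_mem f (by simpa using h2))
        · intro q hq q' hq' h
          exact Prod.ext h ((Finset.mem_filter.1 hq).2.trans (Finset.mem_filter.1 hq').2.symm)
    _ = 1 := by rw [sum_pr_image, h1]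

/-- The common form of the symmetry arguments below: each one exhibits a law-preserving involution
of the outcomes. -/
theorem pr_comp_involutive {τ : Ω → Ω} (hτ : Function.Involutive τ) (hw : ∀ ω, w (τ ω) = w ω)
    {A B : Set Ω} (hAB : ∀ ω ∈ A, τ ω ∈ B) (hBA : ∀ ω ∈ B, τ ω ∈ A) : pr w A = pr w B := by
  classical
  refine Fintype.sum_equiv hτ.toPerm _ _ fun ω => ?_
  have : ω ∈ A ↔ τ ω ∈ B := ⟨hAB ω, fun h => hτ ω ▸ hBA _ h⟩
  simp only [Set.indicator_apply, this, Function.Involutive.coe_toPerm, hw]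

/-- A random variable with equally likely values is uniform. -/
theorem pr_eq_inv_card [Fintype α] [Nonempty α] (h1 : ∑ ω, w ω = 1) (f : Ω → α)
    (h : ∀ a b, pr w {ω | f ω = a} = pr w {ω | f ω = b}) (a : α) :
    pr w {ω | f ω = a} = (Fintype.card α : ℝ)⁻¹ := by
  have := sum_pr_fiber (w := w) f
  rw [h1, Finset.sum_congr rfl (fun b _ => h b a), Finset.sum_const, nsmul_eq_mul,
    Finset.card_univ] at this
  exact eq_inv_of_mul_eq_one_right this

end Information

/-! ### Bit strings -/

theorem bxor_bxor_cancel_right {a : ℕ} (u v : Bits a) : bxor (bxor u v) v = u := by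
  funext t; simp [bxor]

theorem bxor_comm {a : ℕ} (u v : Bits a) : bxor u v = bxor v u := by
  funext t; simp [bxor, Bool.xor_comm]

theorem bxor_assoc {a : ℕ} (u v w : Bits a) : bxor (bxor u v) w = bxor u (bxor v w) := by
  funext t; simp [bxor]

theorem bxor_eq_iff {a : ℕ} (u v w : Bits a) : bxor u v = w ↔ u = bxor w v := by
  constructor
  · rintro rfl; rw [bxor_bxor_cancel_right]
  · rintro rfl; rw [bxor_bxor_cancel_right]

theorem card_bits (a : ℕ) : Fintype.card (Bits a) = 2 ^ a := by simp

/-- The string that is `u` on the positions in `S` and zero elsewhere. -/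
def extend {n a : ℕ} (S : IndexSet n a) (u : Bits a) : Bits n :=
  fun t => if h : t ∈ S.1 then u ((S.1.orderIsoOfFin S.2).symm ⟨t, h⟩) else false

theorem extend_of_notMem {n a : ℕ} {S : IndexSet n a} (u : Bits a) {t : Fin n} (h : t ∉ S.1) :
    extend S u t = false := by
  simp [extend, h]

theorem restrict_extend {n a : ℕ} (S : IndexSet n a) (u : Bits a) :
    restrict (extend S u) S = u := by
  funext t
  have h : S.1.orderEmbOfFin S.2 t ∈ S.1 := Finset.orderEmbOfFin_mem _ _ _
  have h' : (S.1.orderIsoOfFin S.2).symm ⟨S.1.orderEmbOfFin S.2 t, h⟩ = t := by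
    rw [OrderIso.symm_apply_eq]
    rfl
  rw [restrict, extend, dif_pos h, h']

theorem restrict_bxor {n a : ℕ} (x y : Bits n) (S : IndexSet n a) :
    restrict (bxor x y) S = bxor (restrict x S) (restrict y S) := rfl

theorem restrict_congr {n a : ℕ} {β : Type} {x y : Fin n → β} {S : IndexSet n a}
    (h : ∀ t ∈ S.1, x t = y t) : restrict x S = restrict y S :=
  funext fun _ => h _ (Finset.orderEmbOfFin_mem _ _ _)

/-! ### Samplers and announced sets -/

/-- A sampler transported along a permutation of the positions. -/
def permuteSampler {n a : ℕ} (π : Equiv.Perm (Fin n)) (D : Sampler n a) : Sampler n a := fun E =>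
  ⟨(D ⟨E.1.map π.symm.toEmbedding, by simpa using E.2⟩).1.map π.toEmbedding, by
    have h := (D ⟨E.1.map π.symm.toEmbedding, by simpa using E.2⟩).2
    refine ⟨fun t ht => ?_, by rw [Finset.card_map, h.2]⟩
    obtain ⟨s, hs, rfl⟩ := Finset.mem_map.1 ht
    obtain ⟨r, hr, rfl⟩ := Finset.mem_map.1 (h.1 hs)
    simpa using hr⟩

theorem sampler_congr {n a : ℕ} (D : Sampler n a) {E F : Finset (Fin n)} (h : E = F)
    (hE : a ≤ E.card) (hF : a ≤ F.card) : (D ⟨E, hE⟩).1 = (D ⟨F, hF⟩).1 := by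
  subst h; rfl

/-- Equivariance of drawing; pulling the permuted ground set back along `π` recovers `E`. -/
theorem permuteSampler_map {n a : ℕ} (π : Equiv.Perm (Fin n)) (D : Sampler n a)
    {E : Finset (Fin n)} (hE : a ≤ E.card) (hE' : a ≤ (E.map π.toEmbedding).card) :
    (permuteSampler π D ⟨E.map π.toEmbedding, hE'⟩).1 = (D ⟨E, hE⟩).1.map π.toEmbedding := by
  unfold permuteSampler
  dsimp only
  congr 1
  refine sampler_congr D ?_ _ _
  ext t
  simp

theorem permuteSampler_permuteSampler {n a : ℕ} {π : Equiv.Perm (Fin n)}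
    (hπ : Function.Involutive π) (D : Sampler n a) :
    permuteSampler π (permuteSampler π D) = D := by
  have hm : ∀ E : Finset (Fin n), (E.map π.toEmbedding).map π.toEmbedding = E := fun E => by
    ext t
    simp only [Finset.mem_map, Equiv.coe_toEmbedding, exists_exists_and_eq_and, hπ _]
    simp
  funext E
  apply Subtype.ext
  obtain ⟨E, hE⟩ := E
  have h1 : a ≤ (E.map π.toEmbedding).card := by simpa using hE
  have h2 : a ≤ ((E.map π.toEmbedding).map π.toEmbedding).card := by simpa using hE
  rw [← sampler_congr _ (hm E) h2 hE, permuteSampler_map π _ h1, permuteSampler_map π _ hE, hm]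

open Classical in
/-- The announced index sets as a function of the choice bit, the sets of unerased and erased
positions and the samplers. -/
def announce {n a : ℕ} (z : Bool) (F E : Finset (Fin n)) (D D' : Sampler n a) :
    Option (Bool → IndexSet n a) :=
  if h : a ≤ F.card ∧ a ≤ E.card then
    some fun j =>
      if j = z then ⟨(D ⟨F, h.1⟩).1, (D ⟨F, h.1⟩).2.2⟩ else ⟨(D' ⟨E, h.2⟩).1, (D' ⟨E, h.2⟩).2.2⟩
  else none

theorem announce_eq_none_iff {n a : ℕ} {z : Bool} {F E : Finset (Fin n)} {D D' : Sampler n a} :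
    announce z F E D D' = none ↔ F.card < a ∨ E.card < a := by
  unfold announce
  split_ifs with h
  · simpa using ⟨h.1, h.2⟩
  · simp only [true_iff]
    by_contra! h'
    exact h ⟨h'.1, h'.2⟩

theorem announce_subset {n a : ℕ} {z : Bool} {F E : Finset (Fin n)} {D D' : Sampler n a}
    {S : Bool → IndexSet n a} (h : announce z F E D D' = some S) :
    (S z).1 ⊆ F ∧ (S (!z)).1 ⊆ E := by
  unfold announce at h
  split_ifs at h with h0
  obtain rfl := Option.some.inj h
  simp only [if_true, Bool.not_eq_self, if_false]
  exact ⟨(D _).2.1, (D' _).2.1⟩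

/-- Transporting the ground sets and samplers replaces each drawn set by its image. If `π` exchanges
the two drawn sets, flipping the label compensates for this, and the announcement is unchanged. -/
theorem announce_permute {n a : ℕ} {z : Bool} {F E : Finset (Fin n)} {D D' : Sampler n a}
    {π : Equiv.Perm (Fin n)} (hπ : ∀ S, announce z F E D D' = some S →
      ∀ b, (S b).1.map π.toEmbedding = (S (!b)).1) :
    announce (!z) (F.map π.toEmbedding) (E.map π.toEmbedding) (permuteSampler π D)
      (permuteSampler π D') = announce z F E D D' := by
  by_cases h : a ≤ F.card ∧ a ≤ E.card
  · have h' : a ≤ (F.map π.toEmbedding).card ∧ a ≤ (E.map π.toEmbedding).card := by simpa using h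
    unfold announce at hπ ⊢
    rw [dif_pos h']
    rw [dif_pos h] at hπ ⊢
    have h1 := hπ _ rfl z
    have h2 := hπ _ rfl (!z)
    simp only [if_true, Bool.not_eq_self, if_false, Bool.not_not] at h1 h2
    congr 1
    funext j
    apply Subtype.ext
    rcases Bool.eq_or_eq_not j z with rfl | rfl
    · simp only [Bool.eq_not_self, if_false, if_true]
      rw [permuteSampler_map π D' h.2, h2]
    · simp only [Bool.not_eq_self, if_false, if_true]
      rw [permuteSampler_map π D h.1, h1]
  · unfold announce
    rw [dif_neg h, dif_neg (by simpa using h)]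

/-- Match `A \ B` with `B \ A`, which are equinumerous, and fix every other position. -/
theorem exists_swap {n : ℕ} (A B : Finset (Fin n)) (h : A.card = B.card) :
    ∃ π : Equiv.Perm (Fin n), Function.Involutive π ∧ A.map π.toEmbedding = B ∧
      B.map π.toEmbedding = A := by
  have hc : (A \ B).card = (B \ A).card := Finset.card_sdiff_comm h
  obtain ⟨f⟩ : Nonempty ({t // t ∈ A \ B} ≃ {t // t ∈ B \ A}) :=
    ⟨Fintype.equivOfCardEq (by simpa only [Fintype.card_coe] using hc)⟩
  let g : Fin n → Fin n := fun t =>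
    if ht : t ∈ A \ B then f ⟨t, ht⟩ else if ht' : t ∈ B \ A then f.symm ⟨t, ht'⟩ else t
  have g1 : ∀ t (ht : t ∈ A \ B), g t = f ⟨t, ht⟩ := fun t ht => dif_pos ht
  have g2 : ∀ t (ht : t ∈ B \ A), g t = f.symm ⟨t, ht⟩ := fun t ht => by
    have : t ∉ A \ B := by
      simp only [Finset.mem_sdiff] at ht ⊢
      tauto
    simp only [g]
    rw [dif_neg this, dif_pos ht]
  have g3 : ∀ t, t ∉ A \ B → t ∉ B \ A → g t = t := fun t h1 h2 => by
    simp only [g]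
    rw [dif_neg h1, dif_neg h2]
  have hg : Function.Involutive g := by
    intro t
    by_cases h1 : t ∈ A \ B
    · rw [g1 t h1, g2 _ (f ⟨t, h1⟩).2]
      simp
    · by_cases h2 : t ∈ B \ A
      · rw [g2 t h2, g1 _ (f.symm ⟨t, h2⟩).2]
        simp
      · rw [g3 t h1 h2, g3 t h1 h2]
  have hAB : ∀ t ∈ A, g t ∈ B := fun t ht => by
    by_cases h1 : t ∈ A \ B
    · rw [g1 t h1]
      exact (Finset.mem_sdiff.1 (f ⟨t, h1⟩).2).1
    · have : t ∈ B := by simpa [ht] using h1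
      rwa [g3 t h1 (by simp [ht])]
  have hBA : ∀ t ∈ B, g t ∈ A := fun t ht => by
    by_cases h1 : t ∈ B \ A
    · rw [g2 t h1]
      exact (Finset.mem_sdiff.1 (f.symm ⟨t, h1⟩).2).1
    · have : t ∈ A := by simpa [ht] using h1
      rwa [g3 t (by simp [ht]) h1]
  refine ⟨hg.toPerm, hg, ?_, ?_⟩
  · ext t
    simp only [Finset.mem_map, Equiv.coe_toEmbedding, Function.Involutive.coe_toPerm]
    exact ⟨fun ⟨s, hs, hst⟩ => hst ▸ hAB s hs, fun ht => ⟨g t, hBA t ht, hg t⟩⟩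
  · ext t
    simp only [Finset.mem_map, Equiv.coe_toEmbedding, Function.Involutive.coe_toPerm]
    exact ⟨fun ⟨s, hs, hst⟩ => hst ▸ hBA s hs, fun ht => ⟨g t, hAB t ht, hg t⟩⟩

variable {c : Session}

theorem other_ne (i : Fin 2) : other i ≠ i := by fin_cases i <;> decide

theorem prod_eq_mul_other {M : Type*} [CommMonoid M] (f : Fin 2 → M) (i : Fin 2) :
    ∏ j, f j = f i * f (other i) := by
  rw [Fin.prod_univ_two]
  fin_cases i
  · rfl
  · exact mul_comm _ _

/-! ### The law of an outcome -/

/-- The law of `n` independent Bernoulli bits with parameter `p`. -/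
def bernoulliWeight {n : ℕ} (p : ℝ) (u : Fin n → Bool) : ℝ := ∏ t, if u t then p else 1 - p

theorem bernoulliWeight_nonneg {n : ℕ} {p : ℝ} (hp : 0 ≤ p) (hp' : p ≤ 1) (u : Fin n → Bool) :
    0 ≤ bernoulliWeight p u :=
  Finset.prod_nonneg fun t _ => by split_ifs <;> linarith

theorem erasureProb_eq (i : Fin 2) (e : Fin 2 → Fin c.n → Bool) :
    erasureProb c e = bernoulliWeight (c.p i) (e i) *
      bernoulliWeight (c.p (other i)) (e (other i)) :=
  prod_eq_mul_other (fun i => bernoulliWeight (c.p i) (e i)) i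

theorem unif_nonneg (α : Type*) [Fintype α] : 0 ≤ unif α := by
  unfold unif; positivity

theorem law_nonneg (hp : ∀ i, 0 ≤ c.p i ∧ c.p i ≤ 1) (ω : Outcome c) : 0 ≤ law c ω := by
  have h : 0 ≤ erasureProb c ω.e := by
    rw [erasureProb_eq 0]
    exact mul_nonneg (bernoulliWeight_nonneg (hp _).1 (hp _).2 _)
      (bernoulliWeight_nonneg (hp _).1 (hp _).2 _)
  unfold law
  have := unif_nonneg (Fin 2 → Bool)
  have := unif_nonneg ((i : Fin 2) → Bool → Bits (c.k i))
  have := unif_nonneg (Bits c.n)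
  have := unif_nonneg ((i : Fin 2) → Sampler c.n (c.l i))
  have := unif_nonneg ((i : Fin 2) → (j : Bool) → (c.K i j).Seed)
  positivity

/-- Resampling the hash seeds does not change expectations. -/
theorem sum_law_resample_seed (F : Outcome c → ℝ) :
    ∑ ω, law c ω * F ω = ∑ ω, law c ω *
      ∑ s, unif ((i : Fin 2) → (j : Bool) → (c.K i j).Seed) * F { ω with seed := s } := by
  have h : ∀ ω, law c ω * F ω = ∑ s : (i : Fin 2) → (j : Bool) → (c.K i j).Seed,
      law c ω * (unif ((i : Fin 2) → (j : Bool) → (c.K i j).Seed) * F ω) := fun ω => by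
    rw [← Finset.mul_sum, ← Finset.sum_mul, sum_unif, one_mul]
  simp_rw [h, Finset.mul_sum]
  rw [← Fintype.sum_prod_type', ← Fintype.sum_prod_type']
  -- Exchange the seeds of the run with an independent copy; `law` does not depend on their values.
  have hinv : Function.Involutive
      fun q : Outcome c × ((i : Fin 2) → (j : Bool) → (c.K i j).Seed) =>
        (({ q.1 with seed := q.2 } : Outcome c), q.1.seed) := fun q => rfl
  exact Fintype.sum_equiv hinv.toPerm _ _ fun q => rfl

/-- Resampling the erasure pattern does not change expectations. -/
theorem sum_law_resample_erasures (F : Outcome c → ℝ) :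
    ∑ ω, law c ω * F ω = ∑ ω, law c ω * ∑ e, erasureProb c e * F { ω with e := e } := by
  have h : ∀ ω, law c ω * F ω = ∑ e, law c ω * (erasureProb c e * F ω) := fun ω => by
    rw [← Finset.mul_sum, ← Finset.sum_mul, sum_erasureProb, one_mul]
  simp_rw [h, Finset.mul_sum]
  rw [← Fintype.sum_prod_type', ← Fintype.sum_prod_type']
  -- Exchanging the pattern with its copy also exchanges the two factors `erasureProb`, so the joint
  -- weight is symmetric.
  have hinv : Function.Involutive
      fun q : Outcome c × (Fin 2 → Fin c.n → Bool) =>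
        (({ q.1 with e := q.2 } : Outcome c), q.1.e) := fun q => rfl
  refine Fintype.sum_equiv hinv.toPerm _ _ fun q => ?_
  simp only [Function.Involutive.coe_toPerm, law]
  ring

theorem sum_law_const (C : ℝ) : ∑ ω, law c ω * C = C := by
  rw [← Finset.sum_mul, sum_law, one_mul]

theorem sum_law_mul_le (hp : ∀ i, 0 ≤ c.p i ∧ c.p i ≤ 1) {F : Outcome c → ℝ} {C : ℝ}
    (h : ∀ ω, F ω ≤ C) : ∑ ω, law c ω * F ω ≤ C :=
  (Finset.sum_le_sum fun ω _ => mul_le_mul_of_nonneg_left (h ω) (law_nonneg hp ω)).trans_eq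
    (sum_law_const C)

theorem sum_unif_pi {ι : Type*} [Fintype ι] [DecidableEq ι] {β : ι → Type*} [∀ a, Fintype (β a)]
    [∀ a, Nonempty (β a)] (a : ι) (F : β a → ℝ) :
    ∑ s : (a : ι) → β a, unif ((a : ι) → β a) * F (s a) = ∑ b, unif (β a) * F b := by
  have h1 : unif ((a : ι) → β a) = unif (β a) * unif ((b : {b // b ≠ a}) → β b) := by
    unfold unif
    rw [Fintype.card_congr (Equiv.piSplitAt a β), Fintype.card_prod, Nat.cast_mul, mul_inv]
  rw [Fintype.sum_equiv (Equiv.piSplitAt a β) _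
    (fun q => unif (β a) * unif ((b : {b // b ≠ a}) → β b) * F q.1) (fun s => by rw [h1]; rfl),
    Fintype.sum_prod_type]
  refine Finset.sum_congr rfl fun b _ => ?_
  dsimp only
  rw [← Finset.sum_mul, ← Finset.mul_sum, sum_unif, mul_one]

/-- Independence of the two receivers' erasure patterns. -/
theorem sum_erasureProb_mul (i : Fin 2) (F G : (Fin c.n → Bool) → ℝ) :
    ∑ e, erasureProb c e * (F (e i) * G (e (other i))) =
      (∑ u, bernoulliWeight (c.p i) u * F u) * ∑ u, bernoulliWeight (c.p (other i)) u * G u := by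
  let f : Fin 2 → (Fin c.n → Bool) → ℝ := fun j u =>
    bernoulliWeight (c.p j) u * if j = i then F u else G u
  have h1 := Fintype.prod_sum (f := f)
  rw [prod_eq_mul_other _ i] at h1
  simp only [f, if_true, other_ne, if_false] at h1
  rw [h1]
  refine Finset.sum_congr rfl fun e _ => ?_
  rw [prod_eq_mul_other _ i, erasureProb_eq i]
  simp only [if_true, other_ne, if_false]
  ring

theorem sum_bernoulliWeight (n : ℕ) (p : ℝ) : ∑ u : Fin n → Bool, bernoulliWeight p u = 1 := by
  unfold bernoulliWeight
  rw [← Fintype.prod_sum (f := fun (_ : Fin n) (b : Bool) => if b then p else 1 - p)]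
  simp

/-- Independence over time; it yields both the mean of one coordinate and the moment generating
function in the tail bound. -/
theorem sum_bernoulliWeight_mul_prod (n : ℕ) (p : ℝ) (g : Fin n → Bool → ℝ) :
    ∑ u : Fin n → Bool, bernoulliWeight p u * ∏ t, g t (u t) =
      ∏ t, (p * g t true + (1 - p) * g t false) := by
  unfold bernoulliWeight
  simp_rw [← Finset.prod_mul_distrib]
  rw [← Fintype.prod_sum (f := fun (t : Fin n) (b : Bool) => (if b then p else 1 - p) * g t b)]
  simp

theorem sum_bernoulliWeight_mul_coord {n : ℕ} (p : ℝ) (t : Fin n) :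
    ∑ u : Fin n → Bool, bernoulliWeight p u * (if u t then 1 else 0) = p := by
  have h := sum_bernoulliWeight_mul_prod n p
    (fun s b => if s = t then (if b then 1 else 0) else 1)
  simp only [Finset.prod_ite_eq', Finset.mem_univ, if_true] at h
  rw [h, Finset.prod_eq_single t]
  · simp
  · intro s _ hs
    simp [hs]
  · simp

/-! ### Erased positions, announced sets and transcripts -/

namespace Outcome

theorem mem_erased {ω : Outcome c} {i : Fin 2} {t : Fin c.n} :
    t ∈ ω.erased i ↔ ω.e i t = true := by
  simp [erased, y]

theorem mem_unerased {ω : Outcome c} {i : Fin 2} {t : Fin c.n} :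
    t ∈ ω.unerased i ↔ ω.e i t = false := by
  simp [unerased, y]

theorem sets_eq_announce (ω : Outcome c) (i : Fin 2) :
    ω.sets i = announce (ω.z i) (ω.unerased i) (ω.erased i) (ω.drawKnown i) (ω.drawErased i) :=
  rfl

theorem erased_congr {ω ω' : Outcome c} {i : Fin 2} (h : ω'.e i = ω.e i) :
    ω'.erased i = ω.erased i := by
  ext t; simp only [mem_erased, h]

theorem unerased_congr {ω ω' : Outcome c} {i : Fin 2} (h : ω'.e i = ω.e i) :
    ω'.unerased i = ω.unerased i := by
  ext t; simp only [mem_unerased, h]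

theorem sets_congr {ω ω' : Outcome c} {i : Fin 2} (hz : ω'.z i = ω.z i) (he : ω'.e i = ω.e i)
    (hD : ω'.drawKnown i = ω.drawKnown i) (hD' : ω'.drawErased i = ω.drawErased i) :
    ω'.sets i = ω.sets i := by
  rw [sets_eq_announce, sets_eq_announce, hz, hD, hD', erased_congr he, unerased_congr he]

theorem e_of_mem_chosen {ω : Outcome c} {i : Fin 2} {S : Bool → IndexSet c.n (c.l i)}
    (h : ω.sets i = some S) {t : Fin c.n} (ht : t ∈ (S (ω.z i)).1) : ω.e i t = false :=
  mem_unerased.1 ((announce_subset h).1 ht)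

theorem e_of_mem_unchosen {ω : Outcome c} {i : Fin 2} {S : Bool → IndexSet c.n (c.l i)}
    (h : ω.sets i = some S) {t : Fin c.n} (ht : t ∈ (S (!ω.z i)).1) : ω.e i t = true :=
  mem_erased.1 ((announce_subset h).2 ht)

theorem transcript_eq_none_iff {ω : Outcome c} {i : Fin 2} :
    ω.transcript i = none ↔ ω.sets i = none := by
  simp [transcript]

theorem transcript_of_sets_eq {ω : Outcome c} {i : Fin 2} {S : Bool → IndexSet c.n (c.l i)}
    (h : ω.sets i = some S) : ω.transcript i = some
      { sets := S
        seed := ω.seed i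
        masked := fun j => bxor (ω.m i j) ((c.K i j).hash (ω.seed i j) (restrict ω.x (S j))) } := by
  simp [transcript, h]

theorem transcript_congr {ω ω' : Outcome c} {i : Fin 2} (hs : ω'.sets i = ω.sets i)
    (hk : ω'.seed i = ω.seed i)
    (hm : ∀ S, ω.sets i = some S → ∀ j,
      bxor (ω'.m i j) ((c.K i j).hash (ω.seed i j) (restrict ω'.x (S j))) =
      bxor (ω.m i j) ((c.K i j).hash (ω.seed i j) (restrict ω.x (S j)))) :
    ω'.transcript i = ω.transcript i := by
  rcases h : ω.sets i with _ | S
  · rw [transcript_eq_none_iff.2 h, transcript_eq_none_iff.2 (hs.trans h)]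
  · rw [transcript_of_sets_eq h, transcript_of_sets_eq (hs.trans h), hk]
    congr 2
    funext j
    exact hm S h j

/-! ### Perturbing the channel input and the string that was not chosen -/

/-- Add `d` to the channel input and `G x` to the string that receiver `i` has not chosen. -/
def perturb (i : Fin 2) (d : Bits c.n) (G : Bits c.n → Bits (c.k i)) (ω : Outcome c) :
    Outcome c :=
  { ω with
    x := bxor ω.x d
    m := Function.update ω.m i
      (Function.update (ω.m i) (!ω.z i) (bxor (ω.m i (!ω.z i)) (G ω.x))) }

variable {i : Fin 2} {d : Bits c.n} {G : Bits c.n → Bits (c.k i)}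

theorem law_perturb (ω : Outcome c) : law c (perturb i d G ω) = law c ω := rfl

theorem perturb_involutive (hG : ∀ x, G (bxor x d) = G x) :
    Function.Involutive (perturb i d G) := fun ω => by
  have hx : (perturb i d G (perturb i d G ω)).x = ω.x := bxor_bxor_cancel_right _ _
  have hm : (perturb i d G (perturb i d G ω)).m = ω.m := by
    simp [perturb, hG, bxor_bxor_cancel_right]
  exact Outcome.ext rfl hm hx rfl rfl rfl rfl

theorem unchosen_perturb (ω : Outcome c) :
    (perturb i d G ω).unchosen i = bxor (ω.unchosen i) (G ω.x) := by
  simp [unchosen, perturb]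

theorem unchosen_perturb_of_ne (ω : Outcome c) {j : Fin 2} (h : j ≠ i) :
    (perturb i d G ω).unchosen j = ω.unchosen j := by
  simp [unchosen, perturb, h]

/-- By `hd` the input changes only where receiver `i` sees erasures, so its output and the key of
its chosen string stay the same. By `hG` the change of the unchosen string cancels the change of its
key, so the masked string stays the same as well. -/
theorem V_perturb {ω : Outcome c} (hd : ∀ t, ω.e i t = false → d t = false)
    (hG : ∀ S, ω.sets i = some S →
      bxor (G ω.x) ((c.K i (!ω.z i)).hash (ω.seed i (!ω.z i))
        (restrict (bxor ω.x d) (S (!ω.z i)))) =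
      (c.K i (!ω.z i)).hash (ω.seed i (!ω.z i)) (restrict ω.x (S (!ω.z i)))) :
    (perturb i d G ω).V i = ω.V i := by
  have hy : (perturb i d G ω).y i = ω.y i := by
    funext t
    by_cases h : ω.e i t = true
    · simp [y, perturb, h]
    · simp [y, perturb, h, bxor, hd t (by simpa using h)]
  have ht : (perturb i d G ω).transcript i = ω.transcript i := by
    refine transcript_congr (sets_congr rfl rfl rfl rfl) rfl fun S hS j => ?_
    rcases Bool.eq_or_eq_not j (ω.z i) with rfl | rfl
    · have h1 : (perturb i d G ω).m i (ω.z i) = ω.m i (ω.z i) := by simp [perturb]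
      rw [h1, restrict_congr (x := (perturb i d G ω).x) (y := ω.x)]
      intro t ht
      simp [perturb, bxor, hd t (e_of_mem_chosen hS ht)]
    · have h1 : (perturb i d G ω).m i (!ω.z i) = bxor (ω.m i (!ω.z i)) (G ω.x) := by
        simp [perturb]
      rw [h1, bxor_assoc]
      congr 1
      exact hG S hS
  unfold V
  rw [hy, ht]
  rfl

end Outcome

/-! ### Security of the sender against a single receiver -/

theorem eq_iff_eq_bxor_bxor {k : ℕ} (m a κ : Bits k) : m = a ↔ κ = bxor a (bxor m κ) := by
  simp only [funext_iff, bxor]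
  refine forall_congr' fun t => ?_
  cases m t <;> cases a t <;> cases κ t <;> simp

theorem pr_unchosen_add (i : Fin 2) (u : Bits (c.k i)) (A B : Set (Outcome c))
    (h : ∀ ω, ω ∈ A ↔ Outcome.perturb i (fun _ => false) (fun _ => u) ω ∈ B) :
    pr (law c) A = pr (law c) B := by
  have hinv := Outcome.perturb_involutive (i := i) (d := fun _ => false) (G := fun _ => u)
    (fun _ => rfl)
  refine pr_comp_involutive hinv Outcome.law_perturb (fun ω => (h ω).1) fun ω hω => ?_
  rw [h, hinv ω]
  exact hω

theorem pr_unchosen (i : Fin 2) (a : Bits (c.k i)) :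
    pr (law c) {ω | ω.unchosen i = a} = ((2 : ℝ) ^ c.k i)⁻¹ := by
  rw [pr_eq_inv_card (sum_law c) (fun ω => ω.unchosen i) (fun a b => ?_) a, card_bits]
  · push_cast; rfl
  refine pr_unchosen_add i (bxor b a) _ _ fun ω => ?_
  simp only [Set.mem_ofPred_eq, Outcome.unchosen_perturb]
  rw [bxor_eq_iff, bxor_comm b a, ← bxor_assoc, bxor_comm b a, bxor_bxor_cancel_right]

theorem pr_unchosen_pair (q : Bits (c.k 0) × Bits (c.k 1)) :
    pr (law c) {ω | (ω.unchosen 0, ω.unchosen 1) = q} = ((2 : ℝ) ^ (c.k 0 + c.k 1))⁻¹ := by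
  rw [pr_eq_inv_card (sum_law c) (fun ω => (ω.unchosen 0, ω.unchosen 1)) (fun q q' => ?_) q,
    Fintype.card_prod, card_bits, card_bits, pow_add]
  · push_cast; rfl
  have key : ∀ {k : ℕ} (a b u : Bits k), u = a ↔ bxor u (bxor b a) = b := fun a b u => by
    rw [bxor_eq_iff, bxor_comm b a, ← bxor_assoc, bxor_comm b a, bxor_bxor_cancel_right]
  trans pr (law c) {ω | (ω.unchosen 0, ω.unchosen 1) = (q'.1, q.2)}
  · refine pr_unchosen_add 0 (bxor q'.1 q.1) _ _ fun ω => ?_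
    simp only [Set.mem_ofPred_eq, Outcome.unchosen_perturb, Prod.ext_iff,
      Outcome.unchosen_perturb_of_ne ω (one_ne_zero : (1 : Fin 2) ≠ 0)]
    rw [← key]
  · refine pr_unchosen_add 1 (bxor q'.2 q.2) _ _ fun ω => ?_
    simp only [Set.mem_ofPred_eq, Outcome.unchosen_perturb, Prod.ext_iff,
      Outcome.unchosen_perturb_of_ne ω (zero_ne_one : (0 : Fin 2) ≠ 1)]
    rw [← key]

/-- The view of an aborted run contains nothing that depends on the strings, so translating the
unchosen string is invisible in it. -/
theorem pr_unchosen_V_of_none (i : Fin 2) (a : Bits (c.k i)) {v : ReceiverView c i}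
    (hv : v.transcript = none) : pr (law c) {ω | (ω.unchosen i, ω.V i) = (a, v)} =
      ((2 : ℝ) ^ c.k i)⁻¹ * pr (law c) {ω | ω.V i = v} := by
  have hV : ∀ (u : Bits (c.k i)) (ω : Outcome c), ω.V i = v →
      (Outcome.perturb i (fun _ => false) (fun _ => u) ω).V i = v := fun u ω hω => by
    rw [← hω]
    refine Outcome.V_perturb (fun _ _ => rfl) fun S hS => ?_
    have h0 : ω.transcript i = none := by rw [← hv, ← hω]; rfl
    rw [Outcome.transcript_eq_none_iff, hS] at h0
    exact absurd h0 (by simp)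
  have hinv : ∀ u : Bits (c.k i), Function.Involutive (Outcome.perturb i (fun _ => false)
    (fun _ => u)) := fun u => Outcome.perturb_involutive (fun _ => rfl)
  have h : ∀ b, pr (law c) {ω | (ω.unchosen i, ω.V i) = (b, v)} =
      pr (law c) {ω | (ω.unchosen i, ω.V i) = (a, v)} := fun b => by
    refine pr_unchosen_add i (bxor a b) _ _ fun ω => ?_
    have h1 : (Outcome.perturb i (fun _ => false) (fun _ => bxor a b) ω).V i = v ↔ ω.V i = v :=
      ⟨fun h => by simpa [hinv _ ω] using hV (bxor a b) _ h, hV _ ω⟩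
    simp only [Set.mem_ofPred_eq, Outcome.unchosen_perturb, Prod.ext_iff, h1]
    rw [bxor_eq_iff, bxor_comm a b, ← bxor_assoc, bxor_comm a b, bxor_bxor_cancel_right]
  have hsum := sum_pr_fiber_inter (w := law c) (fun ω => ω.unchosen i) (fun ω => ω.V i) v
  rw [Finset.sum_congr rfl (fun b _ => h b), Finset.sum_const, nsmul_eq_mul, Finset.card_univ,
    card_bits] at hsum
  rw [← hsum]
  push_cast
  rw [inv_mul_cancel_left₀ (by positivity)]

open Classical in
-- Given the view, the unchosen string equals `a` exactly when its key is `a` xor the masked string,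
-- and the key is the hash of a substring uniform among `2 ^ l` values. Uniformity comes from
-- shifting that substring by every `u` and correcting the string accordingly.
theorem pr_unchosen_V_of_some (i : Fin 2) (a : Bits (c.k i)) {v : ReceiverView c i}
    {C : Messages c i} (hv : v.transcript = some C) :
    pr (law c) {ω | (ω.unchosen i, ω.V i) = (a, v)} = ((2 : ℝ) ^ c.l i)⁻¹ *
      ((Finset.univ.filter fun x => (c.K i (!v.z)).hash (C.seed (!v.z)) x =
        bxor a (C.masked (!v.z))).card * pr (law c) {ω | ω.V i = v}) := by
  set S := C.sets (!v.z) with hS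
  set g := (c.K i (!v.z)).hash (C.seed (!v.z)) with hg
  have hsets : ∀ ω : Outcome c, ω.V i = v → ω.z i = v.z ∧ ω.sets i = some C.sets ∧
      ω.seed i = C.seed ∧
      C.masked = fun j => bxor (ω.m i j)
        ((c.K i j).hash (ω.seed i j) (restrict ω.x (C.sets j))) := fun ω hω => by
    have h1 : ω.transcript i = some C := by rw [← hv, ← hω]; rfl
    rcases h2 : ω.sets i with _ | S
    · rw [Outcome.transcript_eq_none_iff.2 h2] at h1
      exact absurd h1 (by simp)
    · rw [Outcome.transcript_of_sets_eq h2, Option.some.injEq] at h1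
      subst h1
      exact ⟨by rw [← hω]; rfl, rfl, rfl, rfl⟩
  have hf : ∀ ω : Outcome c, ω.V i = v →
      (ω.unchosen i = a ↔ g (restrict ω.x S) = bxor a (C.masked (!v.z))) := fun ω hω => by
    obtain ⟨hz, h1, h2, h3⟩ := hsets ω hω
    rw [h3, h2, Outcome.unchosen, hz]
    exact eq_iff_eq_bxor_bxor _ _ _
  let d : Bits (c.l i) → Bits c.n := extend S
  -- The xor of the old key and the new one, which is the correction that keeps the masked string
  -- fixed.
  let G : Bits (c.l i) → Bits c.n → Bits (c.k i) := fun u x =>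
    bxor (g (restrict x S)) (g (bxor (restrict x S) u))
  have hd : ∀ u x, restrict (bxor x (d u)) S = bxor (restrict x S) u := fun u x => by
    rw [restrict_bxor, restrict_extend]
  have hinv : ∀ u, Function.Involutive (Outcome.perturb i (d u) (G u)) := fun u =>
    Outcome.perturb_involutive fun x => by
      simp only [G, hd, bxor_bxor_cancel_right]
      exact bxor_comm _ _
  have hV : ∀ u ω, ω.V i = v → (Outcome.perturb i (d u) (G u) ω).V i = v := fun u ω hω => by
    obtain ⟨hz, h1, h2, h3⟩ := hsets ω hω
    rw [← hω]
    refine Outcome.V_perturb (fun t ht => extend_of_notMem _ fun hmem => ?_) fun S' hS' => ?_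
    · have := Outcome.e_of_mem_unchosen h1 (t := t) (by rw [hz]; exact hmem)
      rw [ht] at this
      exact absurd this (by simp)
    · rw [h1, Option.some.injEq] at hS'
      subst hS'
      rw [hz, h2, ← hS, ← hg, hd]
      simp only [G]
      rw [bxor_bxor_cancel_right]
  have hpr : ∀ u, pr (law c) {ω | (ω.unchosen i, ω.V i) = (a, v)} =
      pr (law c) {ω | g (bxor (restrict ω.x S) u) = bxor a (C.masked (!v.z)) ∧ ω.V i = v} := by
    intro u
    have hx : ∀ ω, restrict (Outcome.perturb i (d u) (G u) ω).x S = bxor (restrict ω.x S) u :=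
      fun ω => hd u ω.x
    refine pr_comp_involutive (hinv u) Outcome.law_perturb (fun ω hω => ?_) fun ω hω => ?_
    · obtain ⟨h1, h2⟩ := Prod.ext_iff.1 hω
      refine ⟨?_, hV u ω h2⟩
      rw [hx, bxor_bxor_cancel_right]
      exact (hf ω h2).1 h1
    · refine Prod.ext ((hf _ (hV u ω hω.2)).2 ?_) (hV u ω hω.2)
      rw [hx]
      exact hω.1
  rw [eq_inv_mul_iff_mul_eq₀ (by positivity)]
  calc (2 : ℝ) ^ c.l i * pr (law c) {ω | (ω.unchosen i, ω.V i) = (a, v)}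
      = ∑ u : Bits (c.l i), pr (law c)
          {ω | g (bxor (restrict ω.x S) u) = bxor a (C.masked (!v.z)) ∧ ω.V i = v} := by
        rw [← Finset.sum_congr rfl (fun u _ => hpr u), Finset.sum_const, nsmul_eq_mul,
          Finset.card_univ, card_bits]
        push_cast; rfl
    _ = ∑ ω, ∑ u : Bits (c.l i),
          if g (bxor (restrict ω.x S) u) = bxor a (C.masked (!v.z)) ∧ ω.V i = v
          then law c ω else 0 := by
        simp_rw [pr_eq_sum_ite]
        rw [Finset.sum_comm]
    _ = _ := by
        rw [pr_eq_sum_ite, Finset.mul_sum]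
        refine Finset.sum_congr rfl fun ω _ => ?_
        by_cases hω : ω.V i = v
        · simp only [hω, and_true, if_true]
          -- As `u` runs over all strings so does its xor with the substring, hence the inner sum
          -- counts hash preimages regardless of `ω`.
          have hi : Function.Involutive fun u : Bits (c.l i) => bxor (restrict ω.x S) u :=
            fun u => by
              funext t; simp [bxor]
          refine (Equiv.sum_comp hi.toPerm
            (fun u => if g u = bxor a (C.masked (!v.z)) then law c ω else 0)).trans ?_
          rw [← Finset.sum_filter, Finset.sum_const, nsmul_eq_mul]
        · simp [hω]

/-- Only the single seed with indices `i`, `b` matters. Two-universality handles distinct inputs,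
and the indicator pays for the diagonal. -/
theorem sum_unif_hash_eq_le (i : Fin 2) (b : Bool) (x y : Bits (c.l i)) :
    ∑ s : (i : Fin 2) → (j : Bool) → (c.K i j).Seed,
      unif ((i : Fin 2) → (j : Bool) → (c.K i j).Seed) *
      (if (c.K i b).hash (s i b) x = (c.K i b).hash (s i b) y then (1 : ℝ) else 0) ≤
    ((2 : ℝ) ^ c.k i)⁻¹ + if x = y then 1 else 0 := by
  have h1 := sum_unif_pi (β := fun i => (j : Bool) → (c.K i j).Seed) i
    (fun s => if (c.K i b).hash (s b) x = (c.K i b).hash (s b) y then (1 : ℝ) else 0)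
  have h2 := sum_unif_pi (β := fun j => (c.K i j).Seed) b
    (fun s => if (c.K i b).hash s x = (c.K i b).hash s y then (1 : ℝ) else 0)
  refine (h1.trans h2).trans_le ?_
  by_cases h : x = y
  · subst h
    simp only [if_true, mul_one, sum_unif]
    exact le_add_of_nonneg_left (by positivity)
  · have := (c.K i b).two_universal x y h
    rw [if_neg h, add_zero]
    refine le_trans (le_of_eq ?_) this
    rw [← Finset.mul_sum, Finset.sum_boole, unif, Nat.card_eq_fintype_card,
      Nat.card_eq_fintype_card, Fintype.card_subtype, div_eq_inv_mul]

/-- The leftover hash bound: a receiver learns at most `2 ^ (k - l) / log 2` bits about the string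
that it has not chosen. -/
theorem mutualInfo_unchosen_le (hp : ∀ i, 0 ≤ c.p i ∧ c.p i ≤ 1) (i : Fin 2) :
    mutualInfo (law c) (fun ω => ω.unchosen i) (fun ω => ω.V i) ≤
      ((2 : ℝ) ^ c.k i * ((2 : ℝ) ^ c.l i)⁻¹) / Real.log 2 := by
  classical
  refine mutualInfo_le_of_sum_ratio_le (law_nonneg hp) (sum_law c) _ _ ?_
  -- The likelihood ratio of the unchosen string and the view: `1` after an abort, otherwise a
  -- normalised count of the inputs colliding with the true substring.
  let R : Outcome c → ℝ := fun ω => match ω.sets i with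
    | none => 1
    | some S => (2 : ℝ) ^ c.k i * (((2 : ℝ) ^ c.l i)⁻¹ * ∑ x,
        if (c.K i (!ω.z i)).hash (ω.seed i (!ω.z i)) x =
          (c.K i (!ω.z i)).hash (ω.seed i (!ω.z i)) (restrict ω.x (S (!ω.z i))) then 1 else 0)
  have hR : ∀ ω, law c ω * (pr (law c) {ω' | (ω'.unchosen i, ω'.V i) = (ω.unchosen i, ω.V i)} /
      (pr (law c) {ω' | ω'.unchosen i = ω.unchosen i} * pr (law c) {ω' | ω'.V i = ω.V i})) =
      law c ω * R ω := by
    intro ω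
    rcases (law_nonneg hp ω).eq_or_lt with h0 | h0
    · simp [← h0]
    have hV := pr_fiber_pos (law_nonneg hp) (fun ω => ω.V i) h0
    congr 1
    rw [pr_unchosen]
    rcases hS : ω.sets i with _ | S
    · have hn : (ω.V i).transcript = none := Outcome.transcript_eq_none_iff.2 hS
      rw [pr_unchosen_V_of_none i _ hn, div_self (mul_pos (by positivity) hV).ne']
      simp [R, hS]
    · have hn := Outcome.transcript_of_sets_eq hS
      rw [pr_unchosen_V_of_some i _ (v := ω.V i) hn]
      have hm : ∀ (m κ : Bits (c.k i)), bxor m (bxor m κ) = κ := fun m κ => by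
        funext t; simp [bxor]
      have hc : bxor (ω.unchosen i) (bxor (ω.m i (!(ω.V i).z)) ((c.K i (!(ω.V i).z)).hash
          (ω.seed i (!(ω.V i).z)) (restrict ω.x (S (!(ω.V i).z))))) =
          (c.K i (!ω.z i)).hash (ω.seed i (!ω.z i)) (restrict ω.x (S (!ω.z i))) := hm _ _
      simp only [R, hS, hc]
      rw [Finset.sum_boole]
      have h2 : ((2 : ℝ) ^ c.k i)⁻¹ ≠ 0 := by positivity
      rw [← mul_assoc, mul_div_mul_right _ _ hV.ne', div_inv_eq_mul, mul_comm]
      rfl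
  simp_rw [hR]
  -- The announced sets and the input do not depend on the seeds, so the collision count can be
  -- averaged over fresh seeds with everything else fixed.
  rw [sum_law_resample_seed]
  refine sum_law_mul_le hp fun ω => ?_
  rcases hS : ω.sets i with _ | S
  · have h1 : ∀ s, R { ω with seed := s } = 1 := fun s => by
      have : ({ ω with seed := s } : Outcome c).sets i = none := hS
      simp [R, this]
    simp only [h1, mul_one, sum_unif]
    exact le_add_of_nonneg_right (by positivity)
  · have h1 : ∀ s, R { ω with seed := s } = (2 : ℝ) ^ c.k i * (((2 : ℝ) ^ c.l i)⁻¹ * ∑ x,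
        if (c.K i (!ω.z i)).hash (s i (!ω.z i)) x =
          (c.K i (!ω.z i)).hash (s i (!ω.z i)) (restrict ω.x (S (!ω.z i))) then 1 else 0) :=
        fun s => by
      have : ({ ω with seed := s } : Outcome c).sets i = some S := hS
      simp [R, this]
    have h2 : ∑ s : (i : Fin 2) → (j : Bool) → (c.K i j).Seed,
        unif ((i : Fin 2) → (j : Bool) → (c.K i j).Seed) * ∑ x,
          (if (c.K i (!ω.z i)).hash (s i (!ω.z i)) x =
          (c.K i (!ω.z i)).hash (s i (!ω.z i)) (restrict ω.x (S (!ω.z i))) then (1 : ℝ) else 0) ≤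
        (2 : ℝ) ^ c.l i * ((2 : ℝ) ^ c.k i)⁻¹ + 1 := by
      have h3 := Finset.sum_le_sum fun x (_ : x ∈ Finset.univ) =>
        sum_unif_hash_eq_le i (!ω.z i) x (restrict ω.x (S (!ω.z i)))
      rw [Finset.sum_add_distrib, Finset.sum_ite_eq', if_pos (Finset.mem_univ _), Finset.sum_const,
        nsmul_eq_mul, Finset.card_univ, card_bits, Finset.sum_comm] at h3
      push_cast at h3
      simp_rw [Finset.mul_sum]
      exact h3
    calc _ = (2 : ℝ) ^ c.k i * (((2 : ℝ) ^ c.l i)⁻¹ *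
          ∑ s : (i : Fin 2) → (j : Bool) → (c.K i j).Seed,
          unif ((i : Fin 2) → (j : Bool) → (c.K i j).Seed) * ∑ x,
          if (c.K i (!ω.z i)).hash (s i (!ω.z i)) x =
          (c.K i (!ω.z i)).hash (s i (!ω.z i)) (restrict ω.x (S (!ω.z i))) then (1 : ℝ) else 0) := by
          simp_rw [h1]
          rw [Finset.mul_sum, Finset.mul_sum]
          exact Finset.sum_congr rfl fun s _ => by ring
      _ ≤ (2 : ℝ) ^ c.k i * (((2 : ℝ) ^ c.l i)⁻¹ *
          ((2 : ℝ) ^ c.l i * ((2 : ℝ) ^ c.k i)⁻¹ + 1)) := by gcongr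
      _ = _ := by
          field_simp

/-! ### Security of the receivers against the sender -/

namespace Outcome

/-- Flip the choice bit of receiver `i` and permute its erasure pattern and its samplers. -/
def flipChoice (i : Fin 2) (π : Equiv.Perm (Fin c.n)) (ω : Outcome c) : Outcome c :=
  { ω with
    z := Function.update ω.z i (!ω.z i)
    e := Function.update ω.e i (ω.e i ∘ π)
    drawKnown := Function.update ω.drawKnown i (permuteSampler π (ω.drawKnown i))
    drawErased := Function.update ω.drawErased i (permuteSampler π (ω.drawErased i)) }

variable {i : Fin 2} {π : Equiv.Perm (Fin c.n)}

theorem flipChoice_involutive (hπ : Function.Involutive π) :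
    Function.Involutive (flipChoice (c := c) i π) := fun ω => by
  have h : (ω.e i ∘ π) ∘ π = ω.e i := by
    funext t
    simp [hπ t]
  refine Outcome.ext ?_ rfl rfl ?_ ?_ ?_ rfl <;>
    simp [flipChoice, permuteSampler_permuteSampler hπ, h]

/-- The erasures are identically distributed over time, so permuting them preserves their
probability; the other changed components are uniform. -/
theorem law_flipChoice (ω : Outcome c) : law c (flipChoice i π ω) = law c ω := by
  have h : erasureProb c (flipChoice i π ω).e = erasureProb c ω.e := by
    rw [erasureProb_eq i, erasureProb_eq i]
    simp only [flipChoice, Function.update_self, Function.update_of_ne (other_ne i)]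
    congr 1
    exact Equiv.prod_comp π fun t => if ω.e i t then c.p i else 1 - c.p i
  unfold law
  rw [h]

theorem sets_flipChoice (hπ : Function.Involutive π) {ω : Outcome c}
    (h : ∀ S, ω.sets i = some S → ∀ b, (S b).1.map π.toEmbedding = (S (!b)).1) (j : Fin 2) :
    (flipChoice i π ω).sets j = ω.sets j := by
  by_cases hj : j = i
  · subst hj
    have hm : ∀ E : Finset (Fin c.n), ∀ t, t ∈ E.map π.toEmbedding ↔ π t ∈ E := fun E t => by
      simp only [Finset.mem_map, Equiv.coe_toEmbedding]
      exact ⟨fun ⟨s, hs, hst⟩ => by rwa [← hst, hπ s], fun ht => ⟨π t, ht, hπ t⟩⟩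
    have h1 : (flipChoice j π ω).unerased j = (ω.unerased j).map π.toEmbedding := by
      ext t
      rw [hm, mem_unerased, mem_unerased]
      simp [flipChoice]
    have h2 : (flipChoice j π ω).erased j = (ω.erased j).map π.toEmbedding := by
      ext t
      rw [hm, mem_erased, mem_erased]
      simp [flipChoice]
    rw [sets_eq_announce, h1, h2]
    simp only [flipChoice, Function.update_self]
    exact announce_permute h
  · refine sets_congr ?_ ?_ ?_ ?_ <;> simp [flipChoice, hj]

theorem U_flipChoice (hπ : Function.Involutive π) {ω : Outcome c}
    (h : ∀ S, ω.sets i = some S → ∀ b, (S b).1.map π.toEmbedding = (S (!b)).1) :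
    (flipChoice i π ω).U = ω.U := by
  have ht : (flipChoice i π ω).transcript = ω.transcript := by
    funext j
    exact transcript_congr (sets_flipChoice hπ h j) rfl fun _ _ _ => rfl
  unfold U
  rw [ht]
  rfl

theorem sets_eq_transcript_map (ω : Outcome c) (i : Fin 2) :
    ω.sets i = (ω.transcript i).map Messages.sets := by
  rcases h : ω.sets i with _ | S
  · rw [transcript_eq_none_iff.2 h]; rfl
  · rw [transcript_of_sets_eq h]; rfl

end Outcome

/-- The revealed sets are part of `u`, so one permutation exchanging them serves all outcomes with
this view. -/
theorem pr_z_U_flip (i : Fin 2) (z : Fin 2 → Bool) (u : SenderView c) :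
    pr (law c) {ω | ω.z = z ∧ ω.U = u} =
      pr (law c) {ω | ω.z = Function.update z i (!z i) ∧ ω.U = u} := by
  obtain ⟨π, hπ, h⟩ : ∃ π : Equiv.Perm (Fin c.n), Function.Involutive π ∧
      ∀ C, u.transcript i = some C → ∀ b, (C.sets b).1.map π.toEmbedding = (C.sets (!b)).1 := by
    rcases u.transcript i with _ | C
    -- After an abort nothing has been revealed, and the identity permutation suffices.
    · exact ⟨1, fun _ => rfl, fun C h => by simp at h⟩
    · obtain ⟨π, hπ, h1, h2⟩ := exists_swap (C.sets false).1 (C.sets true).1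
        ((C.sets false).2.trans (C.sets true).2.symm)
      refine ⟨π, hπ, fun C' h b => ?_⟩
      obtain rfl := Option.some.inj h
      cases b
      · exact h1
      · exact h2
  have hU : ∀ ω : Outcome c, ω.U = u → (Outcome.flipChoice i π ω).U = u := fun ω hω => by
    rw [← hω]
    refine Outcome.U_flipChoice hπ fun S hS b => ?_
    rw [Outcome.sets_eq_transcript_map, Option.map_eq_some_iff] at hS
    obtain ⟨C, hC, rfl⟩ := hS
    exact h C (by rw [← hC, ← hω]; rfl) b
  refine pr_comp_involutive (Outcome.flipChoice_involutive hπ) Outcome.law_flipChoice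
    (fun ω hω => ⟨?_, hU ω hω.2⟩) (fun ω hω => ⟨?_, hU ω hω.2⟩)
  · rw [← hω.1]; rfl
  · simp [Outcome.flipChoice, hω.1]

theorem pr_z_U_update (i : Fin 2) (b : Bool) (z : Fin 2 → Bool) (u : SenderView c) :
    pr (law c) {ω | ω.z = z ∧ ω.U = u} =
      pr (law c) {ω | ω.z = Function.update z i b ∧ ω.U = u} := by
  rcases Bool.eq_or_eq_not b (z i) with rfl | rfl
  · rw [Function.update_eq_self]
  · exact pr_z_U_flip i z u

theorem pr_choices_U (q : Bool × Bool) (u : SenderView c) :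
    pr (law c) {ω | ((ω.z 0, ω.z 1), ω.U) = (q, u)} =
      4⁻¹ * pr (law c) {ω | ω.U = u} := by
  have h1 : ∀ q : Bool × Bool, pr (law c) {ω | ((ω.z 0, ω.z 1), ω.U) = (q, u)} =
      pr (law c) {ω | ω.z = (fun _ => false) ∧ ω.U = u} := fun q => by
    rw [pr_z_U_update 0 q.1, pr_z_U_update 1 q.2]
    congr 1
    ext ω
    simp [Prod.ext_iff, funext_iff, Fin.forall_fin_two]
  have hsum := sum_pr_fiber_inter (w := law c) (fun ω => (ω.z 0, ω.z 1)) (fun ω => ω.U) u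
  rw [Finset.sum_congr rfl (fun q _ => h1 q), Finset.sum_const, nsmul_eq_mul, Finset.card_univ,
    ← h1 q] at hsum
  rw [← hsum]
  simp

theorem pr_add_choices (d : Fin 2 → Bool) (A B : Set (Outcome c))
    (h : ∀ ω : Outcome c, ω ∈ A ↔ ({ ω with z := fun i => xor (ω.z i) (d i) } : Outcome c) ∈ B) :
    pr (law c) A = pr (law c) B := by
  have hinv : Function.Involutive
      fun ω : Outcome c => ({ ω with z := fun i => xor (ω.z i) (d i) } : Outcome c) := fun ω => by
    simp
  refine pr_comp_involutive hinv (fun _ => rfl) (fun ω => (h ω).1) fun ω hω => ?_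
  rw [h]
  simpa using hω

theorem pr_choices (q : Bool × Bool) : pr (law c) {ω | (ω.z 0, ω.z 1) = q} = 4⁻¹ := by
  rw [pr_eq_inv_card (sum_law c) (fun ω => (ω.z 0, ω.z 1)) (fun q q' => ?_) q]
  · simp
  refine pr_add_choices ![xor q.1 q'.1, xor q.2 q'.2] _ _ fun ω => ?_
  rcases q with ⟨_ | _, _ | _⟩ <;> rcases q' with ⟨_ | _, _ | _⟩ <;> simp

theorem pr_choice (i : Fin 2) (b : Bool) : pr (law c) {ω | ω.z i = b} = 2⁻¹ := by
  rw [pr_eq_inv_card (sum_law c) (fun ω => ω.z i) (fun b b' => ?_) b]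
  · simp
  refine pr_add_choices (fun _ => xor b b') _ _ fun ω => ?_
  cases b <;> cases b' <;> simp

theorem mutualInfo_choices_U (hp : ∀ i, 0 ≤ c.p i ∧ c.p i ≤ 1) :
    mutualInfo (law c) (fun ω => (ω.z 0, ω.z 1)) (fun ω => ω.U) = 0 := by
  refine le_antisymm ?_ (mutualInfo_nonneg (law_nonneg hp) (sum_law c) _ _)
  rw [← zero_div (Real.log 2)]
  refine mutualInfo_le_of_sum_ratio_le (law_nonneg hp) (sum_law c) _ _ (le_of_eq ?_)
  rw [add_zero, ← sum_law c]
  refine Finset.sum_congr rfl fun ω _ => ?_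
  rcases (law_nonneg hp ω).eq_or_lt with h0 | h0
  · simp [← h0]
  have hU := pr_fiber_pos (law_nonneg hp) (fun ω => ω.U) h0
  rw [pr_choices_U, pr_choices, div_self (mul_pos (by norm_num) hU).ne', mul_one]

/-! ### Correctness and leakage up to the probability of an aborted run -/

/-- The probability that receiver `i` aborts. -/
noncomputable def abortProb (c : Session) (i : Fin 2) : ℝ := pr (law c) {ω | ω.sets i = none}

open Classical in
theorem abortProb_eq_sum (i : Fin 2) :
    abortProb c i = ∑ ω, law c ω * if ω.sets i = none then 1 else 0 := by
  rw [abortProb, pr_eq_sum_ite]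
  simp

theorem pr_decode_ne_le (hp : ∀ i, 0 ≤ c.p i ∧ c.p i ≤ 1) (i : Fin 2) :
    pr (law c) {ω | (ω.V i).decode ≠ some (ω.chosen i)} ≤ abortProb c i := by
  refine pr_mono (law_nonneg hp) fun ω hω => ?_
  by_contra h
  obtain ⟨S, hS⟩ := Option.ne_none_iff_exists'.1 h
  refine hω ?_
  -- The default `false` is never used: the chosen set contains no erased position.
  have hx : restrict (fun t => ((ω.V i).y t).getD false) (S (ω.z i)) =
      restrict ω.x (S (ω.z i)) :=
    restrict_congr fun t ht => by
      simp [Outcome.V, Outcome.y, Outcome.e_of_mem_chosen hS ht]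
  have ht : (ω.V i).transcript = _ := Outcome.transcript_of_sets_eq hS
  rw [ReceiverView.decode, ht, Option.map_some, Option.some.injEq]
  change bxor (bxor _ _) ((c.K i (ω.z i)).hash (ω.seed i (ω.z i))
    (restrict (fun t => ((ω.V i).y t).getD false) (S (ω.z i)))) = _
  rw [hx]
  exact bxor_bxor_cancel_right _ _

theorem entropy_choice (i : Fin 2) : entropy (law c) (fun ω => ω.z i) = 1 := by
  rw [entropy_of_uniform (sum_law c) _ 2 fun ω => pr_choice i _,
    div_self (Real.log_pos one_lt_two).ne']

theorem choiceLeakage_le_one (hp : ∀ i, 0 ≤ c.p i ∧ c.p i ≤ 1) (i : Fin 2) :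
    choiceLeakage c i ≤ 1 :=
  (mutualInfo_le_entropy (law_nonneg hp) _ _).trans_eq (entropy_choice i)

/-- Both values of the bit are allowed for after an abort, and only one is possible otherwise. Two
completed runs with the same data and different bits would put a position of a revealed set both
inside and outside the erased set; `hl` supplies such a position. -/
theorem one_sub_abortProb_le_choiceLeakage (hp : ∀ i, 0 ≤ c.p i ∧ c.p i ≤ 1) (i : Fin 2)
    (hl : 0 < c.l i) : 1 - abortProb c i ≤ choiceLeakage c i := by
  classical
  have hsets : ∀ ω ω' : Outcome c, ω.U = ω'.U → ω.sets i = ω'.sets i := fun ω ω' h => by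
    have h1 : ω.transcript = ω'.transcript := congrArg SenderView.transcript h
    rw [Outcome.sets_eq_transcript_map, Outcome.sets_eq_transcript_map, h1]
  have h := entropy_sub_le_mutualInfo (law_nonneg hp) (sum_law c) (fun ω : Outcome c => ω.z i)
    (fun ω => (ω.U, ω.V (other i), ω.erased i)) (fun ω => if ω.sets i = none then 2 else 1)
    (fun ω ω' h => by
      dsimp only
      rw [hsets ω ω' (Prod.ext_iff.1 h).1])
    (fun ω₀ => by
      by_cases h0 : ω₀.sets i = none
      · rw [if_pos h0]
        exact_mod_cast (Finset.card_le_univ _).trans_eq Fintype.card_bool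
      · rw [if_neg h0]
        obtain ⟨S, hS⟩ := Option.ne_none_iff_exists'.1 h0
        refine Nat.cast_le_one.2 (Finset.card_le_one_iff_subset_singleton.2 ⟨ω₀.z i, ?_⟩)
        intro b hb
        obtain ⟨ω, hω, rfl⟩ := Finset.mem_image.1 hb
        have hω := (Finset.mem_filter.1 hω).2
        simp only [Prod.mk.injEq] at hω
        have hS' := (hsets _ _ hω.1).trans hS
        rw [Finset.mem_singleton]
        by_contra hne
        have hne := (Bool.eq_or_eq_not (ω.z i) (ω₀.z i)).resolve_left hne
        obtain ⟨t, ht⟩ := Finset.card_pos.1 (hl.trans_eq (S (ω.z i)).2.symm)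
        have h1 := Outcome.e_of_mem_chosen hS' ht
        rw [hne] at ht
        have h2 := Outcome.mem_erased.2 (Outcome.e_of_mem_unchosen hS ht)
        rw [← hω.2.2, Outcome.mem_erased, h1] at h2
        exact absurd h2 (by simp))
  refine le_trans (le_of_eq ?_) h
  rw [entropy_choice, abortProb_eq_sum, Finset.sum_div]
  congr 1
  refine Finset.sum_congr rfl fun ω _ => ?_
  split_ifs
  · rw [mul_one, mul_div_cancel_right₀ _ (Real.log_pos one_lt_two).ne']
  · simp

/-! ### What colluding receivers learn -/

theorem card_image_le_of_determined {Ω α γ : Type*} [DecidableEq α] [Fintype γ] (s : Finset Ω)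
    (f : Ω → α) (h : Ω → γ) (H : ∀ ω ∈ s, ∀ ω' ∈ s, h ω = h ω' → f ω = f ω') :
    (s.image f).card ≤ Fintype.card γ := by
  classical
  have hex : ∀ a : {a // a ∈ s.image f}, ∃ ω ∈ s, f ω = a := fun a => Finset.mem_image.1 a.2
  choose φ hφ hφ' using hex
  rw [← Fintype.card_coe]
  refine Fintype.card_le_of_injective (fun a => h (φ a)) fun a b hab => Subtype.ext ?_
  rw [← hφ' a, ← hφ' b]
  exact H _ (hφ a) _ (hφ b) hab

namespace Outcome

/-- The positions announced by receiver `i` for the string that it has not chosen. -/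
def unchosenSet (ω : Outcome c) (i : Fin 2) : Finset (Fin c.n) :=
  match ω.sets i with
  | none => ∅
  | some S => (S (!ω.z i)).1

theorem card_unchosenSet_le (ω : Outcome c) (i : Fin 2) : (ω.unchosenSet i).card ≤ c.l i := by
  unfold unchosenSet
  rcases ω.sets i with _ | S
  · simp
  · exact (S (!ω.z i)).2.le

theorem unchosenSet_congr {ω ω' : Outcome c} {i : Fin 2} (hz : ω'.z i = ω.z i)
    (hs : ω'.sets i = ω.sets i) : ω'.unchosenSet i = ω.unchosenSet i := by
  unfold unchosenSet
  rw [hz, hs]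

end Outcome

/-- The mean number of positions of the unchosen set of receiver `i` that are erased for the other
receiver as well. -/
theorem sum_card_unchosenSet_inter_le (hp : ∀ i, 0 ≤ c.p i ∧ c.p i ≤ 1) (i : Fin 2) :
    ∑ ω, law c ω * ((ω.unchosenSet i ∩ ω.erased (other i)).card : ℝ) ≤
      c.p (other i) * c.l i := by
  rw [sum_law_resample_erasures]
  refine sum_law_mul_le hp fun ω => ?_
  -- The unchosen set depends only on the pattern of receiver `i`, so the pattern given here to the
  -- other receiver is immaterial; this makes the set independent of the other receiver's erasures.
  let A : (Fin c.n → Bool) → Finset (Fin c.n) := fun u =>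
    ({ ω with e := fun _ => u } : Outcome c).unchosenSet i
  have hA : ∀ e, ({ ω with e := e } : Outcome c).unchosenSet i = A (e i) := fun e =>
    Outcome.unchosenSet_congr rfl (Outcome.sets_congr rfl rfl rfl rfl)
  have hcard : ∀ e, ((({ ω with e := e } : Outcome c).unchosenSet i ∩
      ({ ω with e := e } : Outcome c).erased (other i)).card : ℝ) =
      ∑ t, (if t ∈ A (e i) then 1 else 0) * (if e (other i) t then 1 else 0) := fun e => by
    rw [hA]
    simp only [ite_mul, one_mul, zero_mul, ← ite_and]
    rw [Finset.sum_boole]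
    congr 2
    ext t
    simp [Outcome.mem_erased]
  simp_rw [hcard, Finset.mul_sum]
  rw [Finset.sum_comm]
  have h1 : ∀ t : Fin c.n, ∑ e, erasureProb c e *
      ((if t ∈ A (e i) then 1 else 0) * (if e (other i) t then (1 : ℝ) else 0)) =
      c.p (other i) * ∑ u, bernoulliWeight (c.p i) u * if t ∈ A u then 1 else 0 := fun t => by
    rw [sum_erasureProb_mul i (fun u => if t ∈ A u then 1 else 0)
      (fun u => if u t then (1 : ℝ) else 0), sum_bernoulliWeight_mul_coord, mul_comm]
  simp_rw [h1, ← Finset.mul_sum]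
  refine mul_le_mul_of_nonneg_left ?_ (hp _).1
  rw [Finset.sum_comm]
  simp_rw [← Finset.mul_sum]
  calc ∑ u, bernoulliWeight (c.p i) u * ∑ t, (if t ∈ A u then (1 : ℝ) else 0)
      ≤ ∑ u : Fin c.n → Bool, bernoulliWeight (c.p i) u * c.l i := by
        refine Finset.sum_le_sum fun u _ => mul_le_mul_of_nonneg_left ?_
          (bernoulliWeight_nonneg (hp i).1 (hp i).2 u)
        simpa using Outcome.card_unchosenSet_le ({ ω with e := fun _ => u } : Outcome c) i
    _ = c.l i := by rw [← Finset.sum_mul, sum_bernoulliWeight, one_mul]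

theorem le_jointLeakage (hp : ∀ i, 0 ≤ c.p i ∧ c.p i ≤ 1) (i : Fin 2) :
    c.k i * (1 - abortProb c i) - c.p (other i) * c.l i ≤ jointLeakage c := by
  classical
  have hlog : 0 < Real.log 2 := Real.log_pos one_lt_two
  have hV : ∀ ω ω' : Outcome c, (ω.V 0, ω.V 1) = (ω'.V 0, ω'.V 1) → ∀ j, ω.V j = ω'.V j :=
    fun ω ω' h => Fin.forall_fin_two.2 (Prod.ext_iff.1 h)
  have hz : ∀ (ω ω' : Outcome c) j, ω.V j = ω'.V j → ω.z j = ω'.z j :=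
    fun ω ω' j h => congrArg ReceiverView.z h
  have hy : ∀ (ω ω' : Outcome c) j, ω.V j = ω'.V j → ω.y j = ω'.y j :=
    fun ω ω' j h => congrArg ReceiverView.y h
  have ht : ∀ (ω ω' : Outcome c) j, ω.V j = ω'.V j → ω.transcript j = ω'.transcript j :=
    fun ω ω' j h => congrArg ReceiverView.transcript h
  have hsets : ∀ (ω ω' : Outcome c) j, ω.V j = ω'.V j → ω.sets j = ω'.sets j :=
    fun ω ω' j h => by
      rw [Outcome.sets_eq_transcript_map, Outcome.sets_eq_transcript_map, ht ω ω' j h]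
  have her : ∀ (ω ω' : Outcome c) j, ω.V j = ω'.V j → ω.erased j = ω'.erased j :=
    fun ω ω' j h => by
      unfold Outcome.erased
      rw [hy ω ω' j h]
  -- The number of bits that suffice, given both views, to specify the unchosen strings: all of the
  -- other receiver's string, plus the doubly erased input bits of the unchosen set or, after an
  -- abort, the whole string of receiver `i`.
  let N : Outcome c → ℕ := fun ω => c.k (other i) + ((if ω.sets i = none then c.k i else 0) +
    (ω.unchosenSet i ∩ ω.erased (other i)).card)
  have h := entropy_sub_le_mutualInfo (law_nonneg hp) (sum_law c)
    (fun ω : Outcome c => (ω.unchosen 0, ω.unchosen 1)) (fun ω => (ω.V 0, ω.V 1))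
    (fun ω => (2 : ℝ) ^ N ω)
    (fun ω ω' h => by
      have h := hV ω ω' h
      have h1 := hsets ω ω' i (h i)
      simp only [N]
      rw [Outcome.unchosenSet_congr (hz _ _ i (h i)) h1, her _ _ _ (h (other i)), h1])
    (fun ω₀ => by
      have hpair : ∀ ω ω' : Outcome c, ω.unchosen i = ω'.unchosen i →
          ω.unchosen (other i) = ω'.unchosen (other i) →
          (ω.unchosen 0, ω.unchosen 1) = (ω'.unchosen 0, ω'.unchosen 1) := by
        intro ω ω' h1 h2
        fin_cases i
        · exact Prod.ext h1 h2
        · exact Prod.ext h2 h1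
      by_cases h0 : ω₀.sets i = none
      · have hle := card_image_le_of_determined
          (Finset.univ.filter fun ω : Outcome c => (ω.V 0, ω.V 1) = (ω₀.V 0, ω₀.V 1))
          (fun ω => (ω.unchosen 0, ω.unchosen 1))
          (fun ω => (ω.unchosen (other i), ω.unchosen i))
          (fun ω _ ω' _ h => hpair ω ω' (Prod.ext_iff.1 h).2 (Prod.ext_iff.1 h).1)
        rw [Fintype.card_prod, card_bits, card_bits, ← pow_add] at hle
        have hN : c.k (other i) + c.k i ≤ N ω₀ := by
          simp only [N, if_pos h0]
          omega
        exact_mod_cast hle.trans (Nat.pow_le_pow_right two_pos hN)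
      · obtain ⟨S, hS⟩ := Option.ne_none_iff_exists'.1 h0
        have hT : ω₀.unchosenSet i = (S (!ω₀.z i)).1 := by
          simp only [Outcome.unchosenSet, hS]
        have hle := card_image_le_of_determined
          (Finset.univ.filter fun ω : Outcome c => (ω.V 0, ω.V 1) = (ω₀.V 0, ω₀.V 1))
          (fun ω => (ω.unchosen 0, ω.unchosen 1))
          (fun ω => (ω.unchosen (other i),
            fun t : {t // t ∈ ω₀.unchosenSet i ∩ ω₀.erased (other i)} => ω.x t))
          (fun ω hω ω' hω' h => by
            have hω := hV _ _ (Finset.mem_filter.1 hω).2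
            have hω' := hV _ _ (Finset.mem_filter.1 hω').2
            obtain ⟨h1, h2⟩ := Prod.ext_iff.1 h
            refine hpair ω ω' ?_ h1
            have hSω := (hsets _ _ i (hω i)).trans hS
            have hSω' := (hsets _ _ i (hω' i)).trans hS
            have htr := (ht _ _ i (hω i)).trans (ht _ _ i (hω' i)).symm
            rw [Outcome.transcript_of_sets_eq hSω, Outcome.transcript_of_sets_eq hSω',
              Option.some.injEq, Messages.mk.injEq] at htr
            obtain ⟨-, hseed, hm⟩ := htr
            -- Positions erased for the other receiver are covered by the extra data, and the
            -- remaining ones by its channel output. Equal substrings give equal keys, hence equal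
            -- unmasked strings.
            have hx : restrict ω.x (S (!ω₀.z i)) = restrict ω'.x (S (!ω₀.z i)) := by
              refine restrict_congr fun t htS => ?_
              by_cases hte : t ∈ ω₀.erased (other i)
              · exact congrFun h2 ⟨t, Finset.mem_inter.2 ⟨hT ▸ htS, hte⟩⟩
              · have hyt := congrFun ((hy _ _ _ (hω (other i))).trans
                  (hy _ _ _ (hω' (other i))).symm) t
                have e1 : ω.e (other i) t ≠ true := fun he => hte <| by
                  rw [← her _ _ _ (hω (other i))]
                  exact Outcome.mem_erased.2 he
                have e2 : ω'.e (other i) t ≠ true := fun he => hte <| by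
                  rw [← her _ _ _ (hω' (other i))]
                  exact Outcome.mem_erased.2 he
                simpa [Outcome.y, e1, e2] using hyt
            have hmt := congrFun hm (!ω₀.z i)
            rw [hx, hseed, bxor_eq_iff, bxor_bxor_cancel_right] at hmt
            rw [Outcome.unchosen, Outcome.unchosen, hz _ _ i (hω i), hz _ _ i (hω' i), hmt])
        rw [Fintype.card_prod, card_bits, Fintype.card_fun, Fintype.card_bool, Fintype.card_coe,
          ← pow_add] at hle
        have hN : c.k (other i) + (ω₀.unchosenSet i ∩ ω₀.erased (other i)).card ≤ N ω₀ := by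
          simp only [N, if_neg h0]
          omega
        exact_mod_cast hle.trans (Nat.pow_le_pow_right two_pos hN))
  refine le_trans ?_ h
  have hk : c.k 0 + c.k 1 = c.k i + c.k (other i) := by
    fin_cases i
    · rfl
    · exact add_comm _ _
  have hsum : (∑ ω, law c ω * Real.log (2 ^ N ω)) / Real.log 2 = c.k (other i) +
      (c.k i * abortProb c i +
        ∑ ω, law c ω * ((ω.unchosenSet i ∩ ω.erased (other i)).card : ℝ)) := by
    rw [abortProb_eq_sum, Finset.mul_sum, ← Finset.sum_add_distrib,
      ← sum_law_const (c := c) (c.k (other i) : ℝ), ← Finset.sum_add_distrib, Finset.sum_div]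
    refine Finset.sum_congr rfl fun ω _ => ?_
    rw [Real.log_pow, ← mul_assoc, mul_div_cancel_right₀ _ hlog.ne']
    simp only [N]
    push_cast
    split_ifs <;> ring
  have hent : entropy (law c) (fun ω => (ω.unchosen 0, ω.unchosen 1)) =
      c.k i + c.k (other i) := by
    rw [entropy_of_uniform (sum_law c) _ _ fun ω => pr_unchosen_pair _, Real.log_pow,
      mul_div_cancel_right₀ _ hlog.ne', hk]
    push_cast; rfl
  rw [hsum, hent]
  have := sum_card_unchosenSet_inter_le hp i
  linarith

/-! ### Aborted runs are exponentially unlikely -/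

/-- The lower tail of the number of occurrences of `b` among independent Bernoulli bits. -/
theorem exists_tail_bound {p r : ℝ} (hp : 0 ≤ p) (hp' : p ≤ 1) (b : Bool) (hr : 0 < r)
    (hrq : r < if b then p else 1 - p) : ∃ ρ : ℝ, 0 ≤ ρ ∧ ρ < 1 ∧ ∀ n : ℕ,
      ∑ u : Fin n → Bool, bernoulliWeight p u *
        (if ((Finset.univ.filter fun t => u t = b).card : ℝ) ≤ r * n then 1 else 0) ≤ ρ ^ n := by
  set q : ℝ := if b then p else 1 - p with hq
  -- With this value `r * (1 + θ)` is the midpoint of `r` and `q`, so `exp (-θ) ≤ (1 + θ)⁻¹` already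
  -- makes the Chernoff exponent positive.
  set θ : ℝ := (q - r) / (2 * r) with hθ
  have hθ0 : 0 < θ := div_pos (by linarith) (by linarith)
  have hexp : Real.exp (-θ) ≤ (1 + θ)⁻¹ := by
    rw [Real.exp_neg]
    exact inv_anti₀ (by linarith) (by linarith [Real.add_one_le_exp θ])
  have hθr : 0 < q * (1 - Real.exp (-θ)) - θ * r := by
    have h1 : r * (1 + θ) < q := by
      have : r * θ = (q - r) / 2 := by rw [hθ]; field_simp
      linarith
    have h2 : θ * (1 + θ)⁻¹ = 1 - (1 + θ)⁻¹ := by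
      field_simp
      ring
    have h3 : r < q * (1 + θ)⁻¹ := by
      rwa [← div_eq_mul_inv, lt_div_iff₀ (by linarith)]
    have h4 : q * (1 - (1 + θ)⁻¹) ≤ q * (1 - Real.exp (-θ)) :=
      mul_le_mul_of_nonneg_left (by linarith) (by linarith)
    rw [← h2] at h4
    nlinarith
  refine ⟨Real.exp (-(q * (1 - Real.exp (-θ)) - θ * r)), (Real.exp_pos _).le,
    Real.exp_lt_one_iff.2 (by linarith), fun n => ?_⟩
  have hprod : ∀ u : Fin n → Bool, ∏ t, (if u t = b then Real.exp (-θ) else 1) =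
      Real.exp (-θ * (Finset.univ.filter fun t => u t = b).card) := fun u => by
    rw [← Finset.prod_filter, Finset.prod_const, ← Real.exp_nat_mul, mul_comm]
  -- Chernoff's method: bound the indicator by `exp (θ * (r * n - count))`, factor the mean over
  -- time, and use `1 + x ≤ exp x`.
  calc ∑ u : Fin n → Bool, bernoulliWeight p u *
        (if ((Finset.univ.filter fun t => u t = b).card : ℝ) ≤ r * n then 1 else 0)
      ≤ ∑ u : Fin n → Bool, Real.exp (θ * r) ^ n *
        (bernoulliWeight p u * ∏ t, (if u t = b then Real.exp (-θ) else 1)) := by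
        refine Finset.sum_le_sum fun u _ => ?_
        rw [mul_left_comm, hprod, ← Real.exp_nat_mul, ← Real.exp_add]
        refine mul_le_mul_of_nonneg_left ?_ (bernoulliWeight_nonneg hp hp' u)
        split_ifs with h
        · rw [Real.one_le_exp_iff]
          nlinarith
        · exact (Real.exp_pos _).le
    _ = Real.exp (θ * r) ^ n * (q * Real.exp (-θ) + (1 - q)) ^ n := by
        rw [← Finset.mul_sum,
          sum_bernoulliWeight_mul_prod n p (fun _ a => if a = b then Real.exp (-θ) else 1),
          Finset.prod_const, Finset.card_univ, Fintype.card_fin, hq]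
        congr 2
        cases b <;> simp
        ring
    _ ≤ Real.exp (θ * r) ^ n * Real.exp (-(q * (1 - Real.exp (-θ)))) ^ n := by
        have hq1 : q ≤ 1 := by
          rw [hq]
          split_ifs <;> linarith
        have h0 : 0 ≤ q * Real.exp (-θ) + (1 - q) :=
          add_nonneg (mul_nonneg (by linarith) (Real.exp_pos _).le) (by linarith)
        gcongr
        have := Real.add_one_le_exp (-(q * (1 - Real.exp (-θ))))
        linarith
    _ = _ := by
        rw [← mul_pow, ← Real.exp_add]
        congr 2
        ring

/-- A union bound over the two causes of an abort, too few erased and too few unerased positions. -/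
theorem abortProb_le {c : Session} (hp : ∀ i, 0 ≤ c.p i ∧ c.p i ≤ 1) (i : Fin 2) {r : ℝ}
    (hl : (c.l i : ℝ) ≤ r * c.n) : abortProb c i ≤
      ∑ u : Fin c.n → Bool, bernoulliWeight (c.p i) u *
        (if ((Finset.univ.filter fun t => u t = true).card : ℝ) ≤ r * c.n then 1 else 0) +
      ∑ u : Fin c.n → Bool, bernoulliWeight (c.p i) u *
        (if ((Finset.univ.filter fun t => u t = false).card : ℝ) ≤ r * c.n then 1 else 0) := by
  classical
  rw [abortProb_eq_sum, sum_law_resample_erasures]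
  refine sum_law_mul_le hp fun ω => ?_
  have h1 := sum_erasureProb_mul (c := c) i (fun u =>
    (if ((Finset.univ.filter fun t => u t = true).card : ℝ) ≤ r * c.n then 1 else 0) +
    (if ((Finset.univ.filter fun t => u t = false).card : ℝ) ≤ r * c.n then 1 else 0))
    (fun _ => 1)
  simp only [mul_one, sum_bernoulliWeight, mul_add, Finset.sum_add_distrib] at h1
  rw [← h1, ← Finset.sum_add_distrib]
  refine Finset.sum_le_sum fun e _ => ?_
  rw [← mul_add]
  refine mul_le_mul_of_nonneg_left ?_ ?_
  · split_ifs with h h2 h3 h3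
    · norm_num
    · norm_num
    · norm_num
    · exfalso
      rw [Outcome.sets_eq_announce, announce_eq_none_iff] at h
      have e1 : ({ ω with e := e } : Outcome c).unerased i =
          Finset.univ.filter fun t => e i t = false := by
        ext t; simp [Outcome.mem_unerased]
      have e2 : ({ ω with e := e } : Outcome c).erased i =
          Finset.univ.filter fun t => e i t = true := by
        ext t; simp [Outcome.mem_erased]
      rw [e1, e2] at h
      rcases h with h | h
      · exact h3 ((Nat.cast_le.2 h.le).trans hl)
      · exact h2 ((Nat.cast_le.2 h.le).trans hl)
    all_goals norm_num
  · rw [erasureProb_eq i]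
    exact mul_nonneg (bernoulliWeight_nonneg (hp _).1 (hp _).2 _)
      (bernoulliWeight_nonneg (hp _).1 (hp _).2 _)

/-! ### Asymptotics of the pairwise protocol -/

section Asymptotics

variable {p r : Fin 2 → ℝ} {s : ℝ} {K : (n : ℕ) → (i : Fin 2) → Bool →
  TwoUniversalFamily (setSize (r i) n) (stringLength (r i) s n)}

theorem tendsto_abortProb (hp : ∀ i, 0 ≤ p i ∧ p i ≤ 1) (i : Fin 2) (hr0 : 0 < r i)
    (hr : r i < p i) (hr' : r i < 1 - p i) :
    Tendsto (fun n => abortProb (pairwiseProtocol p r s K n) i) atTop (𝓝 0) := by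
  obtain ⟨ρ, h0, h1, h⟩ := exists_tail_bound (hp i).1 (hp i).2 true hr0 (by simpa using hr)
  obtain ⟨ρ', h0', h1', h'⟩ := exists_tail_bound (hp i).1 (hp i).2 false hr0 (by simpa using hr')
  have hlim : Tendsto (fun n => ρ ^ n + ρ' ^ n) atTop (𝓝 0) := by
    simpa using (tendsto_pow_atTop_nhds_zero_of_lt_one h0 h1).add
      (tendsto_pow_atTop_nhds_zero_of_lt_one h0' h1')
  refine squeeze_zero (fun n => pr_nonneg (law_nonneg hp) _) (fun n => ?_) hlim
  exact (abortProb_le (c := pairwiseProtocol p r s K n) hp i (r := r i)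
    (Nat.floor_le (by positivity))).trans (add_le_add (h n) (h' n))

theorem tendsto_hash_bound {r s : ℝ} (hs : 0 < s) (hsr : s < r) :
    Tendsto (fun n => (2 : ℝ) ^ stringLength r s n * ((2 : ℝ) ^ setSize r n)⁻¹ / Real.log 2)
      atTop (𝓝 0) := by
  have h1 : (2 : ℝ) ^ (-s) < 1 := Real.rpow_lt_one_of_one_lt_of_neg one_lt_two (by linarith)
  -- The factor `2` covers the bit lost in rounding `r * n` down; rounding the string length down
  -- only helps.
  have hlim : Tendsto (fun n : ℕ => 2 * ((2 : ℝ) ^ (-s)) ^ n / Real.log 2) atTop (𝓝 0) := by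
    simpa using ((tendsto_pow_atTop_nhds_zero_of_lt_one (by positivity) h1).const_mul 2).div_const
      (Real.log 2)
  have hlog : 0 < Real.log 2 := Real.log_pos one_lt_two
  refine squeeze_zero (fun n => by positivity) (fun n => ?_) hlim
  refine div_le_div_of_nonneg_right ?_ hlog.le
  have hk : (stringLength r s n : ℝ) ≤ (r - s) * n :=
    Nat.floor_le (mul_nonneg (by linarith) n.cast_nonneg)
  have hl : r * n < setSize r n + 1 := Nat.lt_floor_add_one _
  rw [← Real.rpow_natCast, ← Real.rpow_natCast, ← Real.rpow_neg zero_le_two,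
    ← Real.rpow_add two_pos, ← Real.rpow_natCast, ← Real.rpow_mul zero_le_two]
  have h2 : (2 : ℝ) * 2 ^ (-s * n) = 2 ^ (1 + -s * n) := by
    rw [Real.rpow_add two_pos, Real.rpow_one]
  rw [h2]
  exact Real.rpow_le_rpow_of_exponent_le one_le_two (by nlinarith)

theorem tendsto_jointLeakage (hp : ∀ i, 0 ≤ p i ∧ p i ≤ 1) (i : Fin 2) (hr0 : 0 < r i)
    (hr : r i < p i) (hr' : r i < 1 - p i) (hs : s < r i)
    (hi : s < r i * (1 - p (other i))) :
    Tendsto (fun n => jointLeakage (pairwiseProtocol p r s K n)) atTop atTop := by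
  set α : ℝ := r i * (1 - p (other i)) - s with hα
  have hα0 : 0 < α := by linarith
  have habort : ∀ᶠ n in atTop,
      (r i - s) * abortProb (pairwiseProtocol p r s K n) i < α / 2 := by
    have h := (tendsto_abortProb (s := s) (K := K) hp i hr0 hr hr').const_mul (r i - s)
    rw [mul_zero] at h
    exact h.eventually_lt_const (by linarith)
  -- Half of the rate `α` absorbs the loss from aborted runs, and `-1` absorbs the rounding of the
  -- string length.
  have hlin : Tendsto (fun n : ℕ => α / 2 * (n : ℝ) + -1) atTop atTop :=
    tendsto_atTop_add_const_right _ _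
      (tendsto_natCast_atTop_atTop.const_mul_atTop (by linarith))
  refine tendsto_atTop_mono' _ ?_ hlin
  filter_upwards [habort] with n hn
  refine le_trans ?_ (le_jointLeakage (c := pairwiseProtocol p r s K n) hp i)
  set P := abortProb (pairwiseProtocol p r s K n) i
  have hP : 0 ≤ P := pr_nonneg (law_nonneg (c := pairwiseProtocol p r s K n) hp) _
  change _ ≤ (stringLength (r i) s n : ℝ) * (1 - P) - p (other i) * (setSize (r i) n : ℝ)
  have hk : (stringLength (r i) s n : ℝ) ≤ (r i - s) * n :=
    Nat.floor_le (mul_nonneg (by linarith) n.cast_nonneg)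
  have hk' : (r i - s) * n < stringLength (r i) s n + 1 := Nat.lt_floor_add_one _
  have hl : (setSize (r i) n : ℝ) ≤ r i * n := Nat.floor_le (by positivity)
  have h1 := mul_le_mul_of_nonneg_right hk hP
  have h2 := mul_le_mul_of_nonneg_left hl (hp (other i)).1
  have h3 := mul_le_mul_of_nonneg_right hn.le (Nat.cast_nonneg (α := ℝ) n)
  have h4 : α * n = r i * n - p (other i) * (r i * n) - s * n := by rw [hα]; ring
  nlinarith

theorem tendsto_choiceLeakage (hp : ∀ i, 0 ≤ p i ∧ p i ≤ 1) (i : Fin 2) (hr0 : 0 < r i)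
    (hr : r i < p i) (hr' : r i < 1 - p i) :
    Tendsto (fun n => choiceLeakage (pairwiseProtocol p r s K n) i) atTop (𝓝 1) := by
  have h := (tendsto_abortProb (s := s) (K := K) hp i hr0 hr hr').const_sub 1
  rw [sub_zero] at h
  -- For small `n` the revealed sets may be empty and then reveal nothing.
  have hl : ∀ᶠ n : ℕ in atTop, 0 < setSize (r i) n := by
    filter_upwards [(tendsto_natCast_atTop_atTop.const_mul_atTop hr0).eventually_ge_atTop
      (1 : ℝ)] with n hn
    exact Nat.floor_pos.2 hn
  refine tendsto_of_tendsto_of_tendsto_of_le_of_le' h tendsto_const_nhds ?_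
    (Eventually.of_forall fun n => choiceLeakage_le_one hp i)
  filter_upwards [hl] with n hn
  exact one_sub_abortProb_le_choiceLeakage hp i hn

theorem nonColludingSecure (hp : ∀ i, 0 ≤ p i ∧ p i ≤ 1) (hs : 0 < s) (hsr : ∀ i, s < r i)
    (hr : ∀ i, r i < p i) (hr' : ∀ i, r i < 1 - p i) :
    NonColludingSecure (pairwiseProtocol p r s K) where
  correct i := squeeze_zero (fun n => pr_nonneg (law_nonneg hp) _)
    (fun n => pr_decode_ne_le hp i)
    (tendsto_abortProb hp i (hs.trans (hsr i)) (hr i) (hr' i))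
  sender i := squeeze_zero (fun n => mutualInfo_nonneg (law_nonneg hp) (sum_law _) _ _)
    (fun n => mutualInfo_unchosen_le hp i) (tendsto_hash_bound hs (hsr i))
  receivers := by
    have h : ∀ n, mutualInfo (law (pairwiseProtocol p r s K n)) (fun ω => (ω.z 0, ω.z 1))
        (fun ω => ω.U) = 0 := fun n => mutualInfo_choices_U hp
    simp_rw [h]
    exact tendsto_const_nhds

end Asymptotics

end BroadcastOT

/-! ### The main theorem -/

theorem mainTheorem6 (p r : Fin 2 → ℝ) (lam lam' : ℝ)
    (hlam : lam ∈ Set.Ioo (0 : ℝ) 1)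
    (hr : ∀ i, r i < min (p i) (1 - p i) - lam)
    (hlam' : 0 < lam') (hlam'r : ∀ i, lam' < r i)
    (K : (n : ℕ) → (i : Fin 2) → Bool →
      BroadcastOT.TwoUniversalFamily (BroadcastOT.setSize (r i) n)
        (BroadcastOT.stringLength (r i) lam' n)) :
    BroadcastOT.NonColludingSecure (BroadcastOT.pairwiseProtocol p r lam' K) ∧
    (∀ i : Fin 2, Filter.Tendsto
      (fun n => BroadcastOT.choiceLeakage (BroadcastOT.pairwiseProtocol p r lam' K n) i)
      Filter.atTop (nhds 1)) ∧
    ((∃ i : Fin 2, lam' < r i * (1 - p (BroadcastOT.other i))) →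
      Filter.Tendsto
        (fun n => BroadcastOT.jointLeakage (BroadcastOT.pairwiseProtocol p r lam' K n))
        Filter.atTop Filter.atTop ∧
      ¬ BroadcastOT.ColludingSecure (BroadcastOT.pairwiseProtocol p r lam' K)) := by
  have h0 : ∀ i, 0 < r i := fun i => hlam'.trans (hlam'r i)
  have h1 : ∀ i, r i < p i := fun i => by
    linarith [hr i, hlam.1, min_le_left (p i) (1 - p i)]
  have h2 : ∀ i, r i < 1 - p i := fun i => by
    linarith [hr i, hlam.1, min_le_right (p i) (1 - p i)]
  -- That the `p i` are probabilities is not assumed; it follows from `0 < r i` and the two upper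
  -- bounds on `r i`.
  have hp : ∀ i, 0 ≤ p i ∧ p i ≤ 1 := fun i => by
    constructor <;> linarith [h0 i, h1 i, h2 i]
  refine ⟨BroadcastOT.nonColludingSecure hp hlam' hlam'r h1 h2,
    fun i => BroadcastOT.tendsto_choiceLeakage hp i (h0 i) (h1 i) (h2 i), ?_⟩
  rintro ⟨i, hi⟩
  have hjoint := BroadcastOT.tendsto_jointLeakage (K := K) hp i (h0 i) (h1 i) (h2 i)
    (hlam'r i) hi
  -- Of the colluding criteria, the one for the sender alone is already violated.
  exact ⟨hjoint, fun h => not_tendsto_nhds_of_tendsto_atTop hjoint 0 h.sender⟩
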